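/- Theorem 3.9 (EvenUndefinable). Work in $\mathsf{ZF}$ (the axiom of choice is not assumed); equivalently, the following holds in every model of $\mathsf{ZF}$, with all notions interpreted in that model. Conventions: for sets $x,y$ let $\lceil x,y\rceil=\{f_0(u):u\in x\}\cup\{f_1(u):u\in y\}$ be the Quine–Rosser pair, where $f_0(u)=\{s(e):e\in u\}$, $f_1(u)=f_0(u)\cup\{\emptyset\}$, and $s(n)=n+1$ for $n<\omega$, $s(e)=e$ for $e\notin\omega$. For sets $a,b$ let $(a)_x=\{y:\lceil x,y\rceil\in a\}$ and $(a\mid b)=\{(a)_x:x\in b\}$. Let $\alpha$ be an ordinal, let $j:V_\alpha\to V_\alpha$ be a fully elementary map of the structure $(V_\alpha,\in)$ with $j\neq\mathrm{id}$, and let $a,b\in V_\alpha$. Then $j$ is not definable over $V_\alpha$ from any parameter in $(j(a)\mid j(b))$; that is, for every $p\in(j(a)\mid j(b))$ there is no first-order formula $\varphi(v_0,v_1,v_2)$ of the language of set theory such that for all $x,y\in V_\alpha$ $$j(x)=y\iff V_\alpha\models\varphi(x,y,p).$$ -/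

import Mathlib

namespace ChoicelessZF

universe u

/-- The only symbol of the language of set theory: the binary relation symbol for membership. -/
inductive MemRel : ℕ → Type
  | mem : MemRel 2

/-- The first-order language of set theory. -/
def setLang : FirstOrder.Language := ⟨fun _ => Empty, MemRel⟩

/-- A type with a binary relation `∈` is a structure for the language of set theory. -/
instance memStructure (M : Type u) [Membership M M] : setLang.Structure M where
  funMap := fun f => Empty.elim f
  RelMap := fun r => match r with
    | MemRel.mem => fun v => v 0 ∈ v 1

/-- `(M, ∈)` is a model of Zermelo-Fraenkel set theory `ZF`, *without* the axiom of choice.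
No well-foundedness of `M` as seen from outside is assumed. In the two axiom schemata the
classes are those that are first-order definable over `(M, ∈)` from parameters in `M`. -/
class IsZF (M : Type u) [Membership M M] : Prop where
  extensionality : ∀ x y : M, (∀ z, z ∈ x ↔ z ∈ y) → x = y
  foundation : ∀ x : M, (∃ y, y ∈ x) → ∃ y, y ∈ x ∧ ∀ z, z ∈ y → z ∉ x
  pairing : ∀ x y : M, ∃ p : M, ∀ z, z ∈ p ↔ z = x ∨ z = y
  union : ∀ x : M, ∃ w : M, ∀ z, z ∈ w ↔ ∃ y, y ∈ x ∧ z ∈ y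
  powerset : ∀ x : M, ∃ w : M, ∀ y, y ∈ w ↔ ∀ z, z ∈ y → z ∈ x
  infinity : ∃ w : M, (∃ e, e ∈ w ∧ ∀ z, z ∉ e) ∧
    ∀ x, x ∈ w → ∃ y, y ∈ w ∧ ∀ z, z ∈ y ↔ z ∈ x ∨ z = x
  separation : ∀ P : Set M, (Set.univ : Set M).Definable₁ setLang P →
    ∀ x : M, ∃ w : M, ∀ z, z ∈ w ↔ z ∈ x ∧ z ∈ P
  replacement : ∀ R : Set (M × M), (Set.univ : Set M).Definable₂ setLang R →
    ∀ x : M, (∀ y, y ∈ x → ∃! z, (y, z) ∈ R) →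
      ∃ w : M, ∀ z, z ∈ w ↔ ∃ y, y ∈ x ∧ (y, z) ∈ R

variable {M : Type u} [Membership M M] [IsZF M]

/-! All notions below are notions *of* the model `M`: every quantifier ranges over `M`, and
natural numbers, functions, formulas and truth are those of `M`. -/

/-! ### Basic operations -/

theorem exists_empty : ∃ e : M, ∀ z, z ∉ e := by
  obtain ⟨_, ⟨e, _, he⟩, _⟩ := IsZF.infinity (M := M)
  exact ⟨e, he⟩

theorem exists_succ (x : M) : ∃ s : M, ∀ z, z ∈ s ↔ z ∈ x ∨ z = x := by
  obtain ⟨a, ha⟩ := IsZF.pairing x x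
  obtain ⟨b, hb⟩ := IsZF.pairing x a
  obtain ⟨s, hs⟩ := IsZF.union b
  refine ⟨s, fun z => ?_⟩
  rw [hs]
  constructor
  · rintro ⟨y, hy, hz⟩
    rcases (hb y).1 hy with rfl | rfl
    · exact Or.inl hz
    · rcases (ha z).1 hz with h | h <;> exact Or.inr h
  · rintro (h | h)
    · exact ⟨x, (hb x).2 (Or.inl rfl), h⟩
    · exact ⟨a, (hb a).2 (Or.inr rfl), (ha z).2 (Or.inl h)⟩

/-- The empty set of `M`. -/
noncomputable def empty : M := Classical.choose (exists_empty (M := M))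

/-- The unordered pair `{x, y}`. -/
noncomputable def upair (x y : M) : M := Classical.choose (IsZF.pairing x y)

/-- The Kuratowski ordered pair `{{x}, {x, y}}`. -/
noncomputable def opair (x y : M) : M := upair (upair x x) (upair x y)

/-- The successor `x ∪ {x}`. -/
noncomputable def succ (x : M) : M := Classical.choose (exists_succ x)

theorem not_mem_empty (z : M) : z ∉ (empty : M) :=
  Classical.choose_spec (exists_empty (M := M)) z

theorem mem_upair (x y z : M) : z ∈ upair x y ↔ z = x ∨ z = y :=
  Classical.choose_spec (IsZF.pairing x y) z

theorem mem_succ (x z : M) : z ∈ succ x ↔ z ∈ x ∨ z = x :=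
  Classical.choose_spec (exists_succ x) z

/-- The numeral of a concrete natural number in `M`. -/
noncomputable def num : ℕ → M
  | 0 => empty
  | n + 1 => succ (num n)

/-- `n` is a natural number of `M`, that is, it belongs to every inductive set of `M`. -/
def IsNat (n : M) : Prop :=
  ∀ w : M, empty ∈ w → (∀ x, x ∈ w → succ x ∈ w) → n ∈ w

/-- `w` is the set `ω` of `M`. -/
def IsOmega (w : M) : Prop := ∀ n, n ∈ w ↔ IsNat n

/-! ### Functions, ordinals, the cumulative hierarchy -/

/-- `f(x) = y`, for a function `f ∈ M` (a set of ordered pairs). -/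
def App (f x y : M) : Prop := opair x y ∈ f

/-- `f ∈ M` is a function from `A` to `B`. -/
def IsFunction (f A B : M) : Prop :=
  (∀ p, p ∈ f → ∃ x y, x ∈ A ∧ y ∈ B ∧ p = opair x y) ∧ ∀ x, x ∈ A → ∃! y, App f x y

/-- `x` is an ordinal of `M`: it is transitive and linearly ordered by `∈`. -/
def IsOrdinal (x : M) : Prop :=
  (∀ y z, y ∈ x → z ∈ y → z ∈ x) ∧ ∀ y z, y ∈ x → z ∈ x → y ∈ z ∨ y = z ∨ z ∈ y

/-- `α` is an ordinal of `M` and `v = V_α`. The function `f` on `α + 1` is `β ↦ V_β`, the unique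
one with `V_β = ⋃_{γ < β} 𝒫(V_γ)` (so `V_0 = ∅`, `V_{β+1} = 𝒫(V_β)`, and unions at limits). -/
def IsVonNeumann (α v : M) : Prop :=
  IsOrdinal α ∧ ∃ f B : M, IsFunction f (succ α) B ∧
    (∀ β u, App f β u → ∀ x, x ∈ u ↔ ∃ γ t, γ ∈ β ∧ App f γ t ∧ ∀ z, z ∈ x → z ∈ t) ∧
    App f α v

/-! ### Formulas of set theory, coded in `M` -/

/-- The code of the formula `v_i = v_k`. -/
noncomputable def eqCode (i k : M) : M := opair (num 0) (opair i k)

/-- The code of the formula `v_i ∈ v_k`. -/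
noncomputable def memCode (i k : M) : M := opair (num 1) (opair i k)

/-- The code of the negation of `φ`. -/
noncomputable def negCode (φ : M) : M := opair (num 2) φ

/-- The code of the conjunction of `φ` and `ψ`. -/
noncomputable def andCode (φ ψ : M) : M := opair (num 3) (opair φ ψ)

/-- The code of the formula `∃ v_i, φ`. -/
noncomputable def exCode (i φ : M) : M := opair (num 4) (opair i φ)

/-- The set `F` contains the atomic formulas and is closed under the formation rules. -/
def FormulaClosed (F : M) : Prop :=
  (∀ i k, IsNat i → IsNat k → eqCode i k ∈ F ∧ memCode i k ∈ F) ∧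
  (∀ φ, φ ∈ F → negCode φ ∈ F) ∧
  (∀ φ ψ, φ ∈ F → ψ ∈ F → andCode φ ψ ∈ F) ∧
  (∀ i φ, IsNat i → φ ∈ F → exCode i φ ∈ F)

/-- `φ` is (the code of) a first-order formula in the language of set theory. -/
def IsFormula (φ : M) : Prop := ∀ F : M, FormulaClosed F → φ ∈ F

/-! ### Truth in a structure `(A, ∈)` with `A ∈ M` -/

/-- `s` is a function `ω → A`, assigning the value `s(i) ∈ A` to the variable `v_i`. -/
def IsAssignment (A s : M) : Prop := ∃ w : M, IsOmega w ∧ IsFunction s w A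

/-- The assignments `s` and `t` agree except possibly at the variable `v_i`. -/
def AgreeOff (i s t : M) : Prop := ∀ k, IsNat k → k ≠ i → ∀ y, App s k y ↔ App t k y

/-- The set `T` of pairs `(φ, s)` satisfies Tarski's truth clauses for `(A, ∈)`. -/
def IsTruthSet (A T : M) : Prop :=
  ∀ s, IsAssignment A s →
    (∀ i k, IsNat i → IsNat k →
      (opair (eqCode i k) s ∈ T ↔ ∃ y, App s i y ∧ App s k y)) ∧
    (∀ i k, IsNat i → IsNat k →
      (opair (memCode i k) s ∈ T ↔ ∃ y z, App s i y ∧ App s k z ∧ y ∈ z)) ∧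
    (∀ φ, IsFormula φ → (opair (negCode φ) s ∈ T ↔ opair φ s ∉ T)) ∧
    (∀ φ ψ, IsFormula φ → IsFormula ψ →
      (opair (andCode φ ψ) s ∈ T ↔ opair φ s ∈ T ∧ opair ψ s ∈ T)) ∧
    (∀ i φ, IsNat i → IsFormula φ →
      (opair (exCode i φ) s ∈ T ↔
        ∃ t, IsAssignment A t ∧ AgreeOff i s t ∧ opair φ t ∈ T))

/-- `(A, ∈) ⊨ φ[s]`. -/
def Satisfies (A φ s : M) : Prop := ∃ T : M, IsTruthSet A T ∧ opair φ s ∈ T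

/-- `j` is a fully elementary map `(A, ∈) → (A, ∈)`: a function with
`A ⊨ φ[s] ↔ A ⊨ φ[j ∘ s]` for all formulas `φ` and all assignments `s`. -/
def IsElementary (A j : M) : Prop :=
  IsFunction j A A ∧
  ∀ φ, IsFormula φ → ∀ s t, IsAssignment A s → IsAssignment A t →
    (∀ k x y, App s k x → App j x y → App t k y) →
    (Satisfies A φ s ↔ Satisfies A φ t)

/-- The function `j : A → A` is definable over `(A, ∈)` from the parameter `p ∈ A`: there is a
formula `φ(v_0, v_1, v_2)` with `j(x) = y ↔ A ⊨ φ(x, y, p)` for all `x, y ∈ A`. (All variables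
other than `v_0` and `v_1` are given the value `p`, so that `p` is the only parameter.) -/
def DefinableFrom (A j p : M) : Prop :=
  p ∈ A ∧ ∃ φ, IsFormula φ ∧ ∀ x y, x ∈ A → y ∈ A →
    (App j x y ↔ ∃ s, IsAssignment A s ∧ App s (num 0) x ∧ App s (num 1) y ∧
      (∀ k, IsNat k → k ≠ num 0 → k ≠ num 1 → App s k p) ∧ Satisfies A φ s)

/-! ### Quine-Rosser pairs and the sets `(a | b)` -/

open Classical in
/-- The map sending each natural number `n` to `n + 1` and fixing all other sets. -/
noncomputable def shift (x : M) : M := if IsNat x then succ x else x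

/-- `w = f₀(x)`, the pointwise image of `x` under `shift`. -/
def IsTagZero (w x : M) : Prop := ∀ t, t ∈ w ↔ ∃ e, e ∈ x ∧ t = shift e

/-- `w = f₁(x)`, which is `f₀(x) ∪ {∅}`. -/
def IsTagOne (w x : M) : Prop := ∀ t, t ∈ w ↔ t = empty ∨ ∃ e, e ∈ x ∧ t = shift e

/-- `z` is the Quine-Rosser pair `⌈x, y⌉ = {f₀(u) : u ∈ x} ∪ {f₁(u) : u ∈ y}`. -/
def IsQRPair (z x y : M) : Prop :=
  ∀ w, w ∈ z ↔ (∃ u, u ∈ x ∧ IsTagZero w u) ∨ ∃ u, u ∈ y ∧ IsTagOne w u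

/-- `c` is the section `(a)_x = {y : ⌈x, y⌉ ∈ a}`. -/
def IsSection (c a x : M) : Prop := ∀ y, y ∈ c ↔ ∃ z, z ∈ a ∧ IsQRPair z x y

/-- `p ∈ (a | b)`, where `(a | b) = {(a)_x : x ∈ b}`. -/
def MemSections (p a b : M) : Prop := ∃ x, x ∈ b ∧ IsSection p a x


end ChoicelessZF

/-! Suppose that `j` is definable over `V` from `p`. Consider all maps `k : V → V` that preserve
formulas and are definable over `V` from a section `(k(a))_x` with `x ∈ k(b)`, for any `a`, `b`.
Among the sets moved by such maps take an `∈`-minimal `z`, moved by `k`, where `φ` defines `k` from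
`p = (k(a))_x`. Every element of `z` is fixed by `k`, so `k(z)` has a moved element: otherwise `z`
and `k(z)` would have the same elements. Thus, over `V`, some `x ∈ k(b)` is such that `φ` defines
from `(k(a))_x` a map that moves an element of `k(z)` and whose parameter is again a section of one
of its images at an element of another. Pulling this back along `k` gives `y ∈ b` such that the map
`k₁` defined by `φ` from `(a)_y` moves an element of `z` and has its parameter of the required form.
If `k₁` preserves formulas, this contradicts the minimality of `z`.

The obstacle is that preservation of all formulas is not a single first-order statement over `V`. It
is replaced by a parameter: the set `C` of codes of pairs `(ψ, y)` with `y ∈ b` such that `ψ` is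
preserved by the relation that `φ` defines from `(a)_y` (`exists_preservation_set`). Since `k` fixes
hereditarily finite sets, hence formulas, elementarity applied to each `ψ` separately puts the code
of `(ψ, x)` into `k(C)`. That all codes at `x` lie in `k(C)` is one statement, and it can be pulled
back (`reflects_of_isDefinedBy`, `exists_moved_of_definableFrom`).

For this `C` must be an element of `V`, even for successor `α`, where Kuratowski pairs raise the
rank too far. The codes of `IsFlatPair` do not raise the rank from a limit level on, and there is a
limit level below `α` (`exists_isLimitLevel`).

Only formulas evaluated at five values need to be preserved. This makes preservation of a given
formula a statement about tuples from `V`, whereas assignments `ω → V` need not belong to `V`. The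
calculus `FODef` is used twice: `ambient` feeds separation in `M`, and `inner` produces formulas of
`M` that are evaluated in `V`. -/

namespace ChoicelessZF

universe u

/-! ### Families of first-order definable predicates -/

/-- A family of predicates of finitely many variables that is closed under the first-order
operations. -/
structure FODef (X : Type u) [Membership X X] where
  Holds : ∀ {n : ℕ}, ((Fin n → X) → Prop) → Prop
  mem : ∀ {n : ℕ} (i k : Fin n), Holds fun v => v i ∈ v k
  eq : ∀ {n : ℕ} (i k : Fin n), Holds fun v => v i = v k
  not : ∀ {n : ℕ} {P : (Fin n → X) → Prop}, Holds P → Holds fun v => ¬ P v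
  and : ∀ {n : ℕ} {P Q : (Fin n → X) → Prop}, Holds P → Holds Q → Holds fun v => P v ∧ Q v
  ex : ∀ {n : ℕ} {P : (Fin (n + 1) → X) → Prop}, Holds P →
    Holds fun v : Fin n → X => ∃ x, P (Fin.cons x v)
  rename : ∀ {m n : ℕ} (ρ : Fin m → Fin n) {P : (Fin m → X) → Prop}, Holds P →
    Holds fun v : Fin n → X => P fun i => v (ρ i)

section FODef

variable {X : Type u} [Membership X X]

/-- `P` belongs to the family `S`. -/
class Dfn (S : FODef X) {n : ℕ} (P : (Fin n → X) → Prop) : Prop where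
  out : S.Holds P

/-- The graph of the function `g` belongs to the family `S`. -/
class DfnFun (S : FODef X) {n : ℕ} (g : (Fin n → X) → X) : Prop where
  out : S.Holds fun v : Fin (n + 1) → X => v 0 = g fun i => v i.succ

variable {S : FODef X} {n : ℕ}

theorem FODef.congr {P Q : (Fin n → X) → Prop} (hP : S.Holds P) (h : ∀ v, P v ↔ Q v) :
    S.Holds Q := by
  have : P = Q := funext fun v => propext (h v)
  exact this ▸ hP

theorem Dfn.congr {P Q : (Fin n → X) → Prop} (hP : Dfn S P) (h : ∀ v, Q v ↔ P v) : Dfn S Q :=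
  ⟨FODef.congr hP.out fun v => (h v).symm⟩

instance Dfn.not {P : (Fin n → X) → Prop} [h : Dfn S P] : Dfn S fun v => ¬ P v := ⟨S.not h.out⟩

instance Dfn.and {P Q : (Fin n → X) → Prop} [h : Dfn S P] [h' : Dfn S Q] :
    Dfn S fun v => P v ∧ Q v := ⟨S.and h.out h'.out⟩

instance Dfn.or {P Q : (Fin n → X) → Prop} [h : Dfn S P] [h' : Dfn S Q] :
    Dfn S fun v => P v ∨ Q v :=
  ⟨FODef.congr (S.not (S.and (S.not h.out) (S.not h'.out))) fun v => by tauto⟩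

instance Dfn.imp {P Q : (Fin n → X) → Prop} [h : Dfn S P] [h' : Dfn S Q] :
    Dfn S fun v => P v → Q v :=
  ⟨FODef.congr (S.not (S.and h.out (S.not h'.out))) fun v => by tauto⟩

instance Dfn.iff {P Q : (Fin n → X) → Prop} [Dfn S P] [Dfn S Q] :
    Dfn S fun v => P v ↔ Q v :=
  (inferInstance : Dfn S fun v => (P v → Q v) ∧ (Q v → P v)).congr fun _ => iff_def

instance Dfn.exists {P : (Fin n → X) → X → Prop}
    [h : Dfn S fun w : Fin (n + 1) → X => P (fun i => w i.succ) (w 0)] :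
    Dfn S fun v => ∃ x, P v x := ⟨S.ex h.out⟩

instance Dfn.forall {P : (Fin n → X) → X → Prop}
    [h : Dfn S fun w : Fin (n + 1) → X => P (fun i => w i.succ) (w 0)] :
    Dfn S fun v => ∀ x, P v x :=
  ⟨FODef.congr (S.not (S.ex (S.not h.out))) fun v => by
    simp only [not_exists, not_not, Fin.cons_zero, Fin.cons_succ]⟩

theorem Dfn.rename {m : ℕ} {P : (Fin m → X) → Prop} (h : Dfn S P) (ρ : Fin m → Fin n) :
    Dfn S fun v : Fin n → X => P fun i => v (ρ i) := ⟨S.rename ρ h.out⟩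

instance DfnFun.var (i : Fin n) : DfnFun S fun v : Fin n → X => v i := ⟨S.eq 0 i.succ⟩

theorem DfnFun.weaken {g : (Fin n → X) → X} (h : DfnFun S g) :
    DfnFun S fun w : Fin (n + 1) → X => g fun i => w i.succ :=
  ⟨S.rename (Fin.cases 0 fun i => i.succ.succ) h.out⟩

theorem FODef.subst {P : (Fin (n + 1) → X) → Prop} (hP : S.Holds P) {g : (Fin n → X) → X}
    (hg : DfnFun S g) : S.Holds fun v : Fin n → X => P (Fin.cons (g v) v) :=
  FODef.congr (S.ex (S.and hg.out hP)) fun v => by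
    constructor
    · rintro ⟨x, h, h'⟩
      simp only [Fin.cons_zero, Fin.cons_succ] at h
      exact h ▸ h'
    · intro h
      exact ⟨g v, by simp, h⟩

/-- The first argument is parked as a new coordinate of the context while the recursion substitutes
the others; `FODef.subst` then eliminates it. The induction needs `P` to depend on the context as
well. -/
theorem FODef.comp_aux : ∀ (k : ℕ) {n : ℕ} (P : (Fin k → X) → (Fin n → X) → Prop)
    (g : Fin k → (Fin n → X) → X),
    (S.Holds fun w : Fin (n + k) → X =>
      P (fun i => w (Fin.natAdd n i)) (fun i => w (Fin.castAdd k i))) →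
    (∀ i, DfnFun S (g i)) → S.Holds fun v => P (fun i => g i v) v
  | 0, _, _, _, hP, _ =>
      FODef.congr hP fun _ => iff_of_eq (congrArg₂ _ (Subsingleton.elim _ _) rfl)
  | k + 1, n, P, g, hP, hg => by
      have h1 := S.rename (Fin.addCases (fun i => Fin.castAdd k i.succ)
        (Fin.cases (Fin.castAdd k 0) (Fin.natAdd (n + 1))) : Fin (n + (k + 1)) → Fin (n + 1 + k)) hP
      have h2 := FODef.comp_aux k
        (fun y (u : Fin (n + 1) → X) => P (Fin.cons (u 0) y) fun i => u i.succ)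
        (fun i u => g i.succ fun l => u l.succ) (FODef.congr h1 fun w => by
          simp only [Fin.addCases_left, Fin.addCases_right]
          refine iff_of_eq (congrArg₂ P ?_ rfl)
          funext i
          refine Fin.cases ?_ (fun i => ?_) i <;> simp) fun i => (hg i.succ).weaken
      refine FODef.congr (FODef.subst h2 (hg 0)) fun v => iff_of_eq (congrArg₂ P ?_ rfl)
      funext i
      refine Fin.cases ?_ (fun i => ?_) i <;> simp

theorem Dfn.comp {k : ℕ} {P : (Fin k → X) → Prop} (hP : Dfn S P) (g : Fin k → (Fin n → X) → X)
    (hg : ∀ i, DfnFun S (g i)) : Dfn S fun v => P fun i => g i v :=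
  ⟨FODef.comp_aux k (fun y _ => P y) g (S.rename (Fin.natAdd n) hP.out) hg⟩

variable {g₁ g₂ g₃ g₄ g₅ : (Fin n → X) → X}

theorem Dfn.comp₁ (R : X → Prop) (h : Dfn S fun v : Fin 1 → X => R (v 0)) [h₁ : DfnFun S g₁] :
    Dfn S fun v => R (g₁ v) :=
  h.comp ![g₁] fun i => by fin_cases i; exact h₁

theorem Dfn.comp₂ (R : X → X → Prop) (h : Dfn S fun v : Fin 2 → X => R (v 0) (v 1))
    [h₁ : DfnFun S g₁] [h₂ : DfnFun S g₂] : Dfn S fun v => R (g₁ v) (g₂ v) :=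
  h.comp ![g₁, g₂] fun i => by fin_cases i <;> assumption

theorem Dfn.comp₃ (R : X → X → X → Prop) (h : Dfn S fun v : Fin 3 → X => R (v 0) (v 1) (v 2))
    [h₁ : DfnFun S g₁] [h₂ : DfnFun S g₂] [h₃ : DfnFun S g₃] :
    Dfn S fun v => R (g₁ v) (g₂ v) (g₃ v) :=
  h.comp ![g₁, g₂, g₃] fun i => by fin_cases i <;> assumption

theorem Dfn.comp₄ (R : X → X → X → X → Prop)
    (h : Dfn S fun v : Fin 4 → X => R (v 0) (v 1) (v 2) (v 3))
    [h₁ : DfnFun S g₁] [h₂ : DfnFun S g₂] [h₃ : DfnFun S g₃] [h₄ : DfnFun S g₄] :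
    Dfn S fun v => R (g₁ v) (g₂ v) (g₃ v) (g₄ v) :=
  h.comp ![g₁, g₂, g₃, g₄] fun i => by fin_cases i <;> assumption

theorem Dfn.comp₅ (R : X → X → X → X → X → Prop)
    (h : Dfn S fun v : Fin 5 → X => R (v 0) (v 1) (v 2) (v 3) (v 4))
    [h₁ : DfnFun S g₁] [h₂ : DfnFun S g₂] [h₃ : DfnFun S g₃] [h₄ : DfnFun S g₄]
    [h₅ : DfnFun S g₅] :
    Dfn S fun v => R (g₁ v) (g₂ v) (g₃ v) (g₄ v) (g₅ v) :=
  h.comp ![g₁, g₂, g₃, g₄, g₅] fun i => by fin_cases i <;> assumption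

instance Dfn.mem [DfnFun S g₁] [DfnFun S g₂] : Dfn S fun v => g₁ v ∈ g₂ v :=
  Dfn.comp₂ (fun x y => x ∈ y) ⟨S.mem 0 1⟩

instance Dfn.eq [DfnFun S g₁] [DfnFun S g₂] : Dfn S fun v => g₁ v = g₂ v :=
  Dfn.comp₂ (fun x y => x = y) ⟨S.eq 0 1⟩

instance Dfn.ne [DfnFun S g₁] [DfnFun S g₂] : Dfn S fun v => g₁ v ≠ g₂ v :=
  (inferInstance : Dfn S fun v => ¬ g₁ v = g₂ v)

instance Dfn.existsUnique {P : (Fin n → X) → X → Prop}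
    [h : Dfn S fun w : Fin (n + 1) → X => P (fun i => w i.succ) (w 0)] :
    Dfn S fun v => ∃! x, P v x := by
  have h' : Dfn S fun w : Fin (n + 1 + 1) → X => P (fun i => w i.succ.succ) (w 0) :=
    h.rename (Fin.cases 0 fun i => i.succ.succ)
  exact (inferInstance : Dfn S fun v => ∃ x, P v x ∧ ∀ y, P v y → y = x)

theorem DfnFun.comp₁ (F : X → X) (h : Dfn S fun v : Fin 2 → X => v 0 = F (v 1))
    [h₁ : DfnFun S g₁] : DfnFun S fun v => F (g₁ v) :=
  have := h₁.weaken
  ⟨(Dfn.comp₂ (g₁ := fun w : Fin (n + 1) → X => w 0) (g₂ := fun w => g₁ fun i => w i.succ)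
    (fun y x => y = F x) h).out⟩

theorem DfnFun.comp₂ (F : X → X → X) (h : Dfn S fun v : Fin 3 → X => v 0 = F (v 1) (v 2))
    [h₁ : DfnFun S g₁] [h₂ : DfnFun S g₂] : DfnFun S fun v => F (g₁ v) (g₂ v) :=
  have := h₁.weaken
  have := h₂.weaken
  ⟨(Dfn.comp₃ (g₁ := fun w : Fin (n + 1) → X => w 0) (g₂ := fun w => g₁ fun i => w i.succ)
    (g₃ := fun w => g₂ fun i => w i.succ) (fun y x z => y = F x z) h).out⟩

end FODef

/-! ### Predicates definable over `M` with parameters -/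

section Ambient

variable (M : Type u) [Membership M M]

/-- The family of predicates that are first-order definable over `(M, ∈)` with parameters. -/
def ambient : FODef M where
  Holds := fun {_} P => (Set.univ : Set M).Definable setLang {v | P v}
  mem := fun i k => by
    refine Set.Definable.mono (A := ∅) ?_ (Set.empty_subset _)
    rw [Set.empty_definable_iff]
    refine ⟨FirstOrder.Language.Relations.formula₂ (L := setLang) MemRel.mem
      (FirstOrder.Language.Term.var i) (FirstOrder.Language.Term.var k), ?_⟩
    ext v
    simp only [Set.mem_ofPred_eq]
    exact Iff.rfl
  eq := fun i k => by
    refine Set.Definable.mono (A := ∅) ?_ (Set.empty_subset _)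
    rw [Set.empty_definable_iff]
    refine ⟨FirstOrder.Language.Term.equal (L := setLang)
      (FirstOrder.Language.Term.var i) (FirstOrder.Language.Term.var k), ?_⟩
    ext v
    simp
  not := fun h => h.compl
  and := fun h h' => h.inter h'
  ex := fun {n P} h => by
    have := h.image_comp (Fin.succ : Fin n → Fin (n + 1))
    convert this using 1
    ext v
    constructor
    · rintro ⟨x, hx⟩
      exact ⟨Fin.cons x v, hx, by ext; simp⟩
    · rintro ⟨w, hw, rfl⟩
      refine ⟨w 0, ?_⟩
      have : (Fin.cons (w 0) (w ∘ Fin.succ) : Fin (n + 1) → M) = w := Fin.cons_self_tail w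
      rw [this]
      exact hw
  rename := fun {_ _} ρ {_} h => h.preimage_comp ρ

end Ambient

/-! ### Definability over `M` of the notions in the statement -/

section Instances

variable {M : Type u} [Membership M M] {n : ℕ}

instance DfnFun.const (c : M) : DfnFun (ambient M) fun _ : Fin n → M => c :=
  ⟨⟨FirstOrder.Language.Term.equal (FirstOrder.Language.Term.var 0)
    (FirstOrder.Language.Constants.term (setLang.con ⟨c, trivial⟩)), by
    ext v
    simp⟩⟩

variable [IsZF M]

theorem ext {x y : M} (h : ∀ z, z ∈ x ↔ z ∈ y) : x = y := IsZF.extensionality x y h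

theorem exists_sep (P : M → Prop) [h : Dfn (ambient M) fun v : Fin 1 → M => P (v 0)] (x : M) :
    ∃ w : M, ∀ z, z ∈ w ↔ z ∈ x ∧ P z :=
  IsZF.separation {z | P z} h.out x

variable {g₁ g₂ g₃ g₄ g₅ : (Fin n → M) → M}

variable [DfnFun (ambient M) g₁] [DfnFun (ambient M) g₂] [DfnFun (ambient M) g₃]
  [DfnFun (ambient M) g₄] [DfnFun (ambient M) g₅]

theorem eq_upair_iff {p x y : M} : p = upair x y ↔ ∀ z, z ∈ p ↔ z = x ∨ z = y :=
  ⟨fun h z => h ▸ mem_upair x y z, fun h => ext fun z => (h z).trans (mem_upair x y z).symm⟩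

theorem eq_succ_iff {s x : M} : s = succ x ↔ ∀ z, z ∈ s ↔ z ∈ x ∨ z = x :=
  ⟨fun h z => h ▸ mem_succ x z, fun h => ext fun z => (h z).trans (mem_succ x z).symm⟩

instance dfnFun_upair : DfnFun (ambient M) fun v => upair (g₁ v) (g₂ v) :=
  DfnFun.comp₂ upair (by simp only [eq_upair_iff]; infer_instance)

instance dfnFun_opair : DfnFun (ambient M) fun v => opair (g₁ v) (g₂ v) :=
  inferInstanceAs (DfnFun (ambient M) fun v => upair (upair (g₁ v) (g₁ v)) (upair (g₁ v) (g₂ v)))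

instance dfnFun_succ : DfnFun (ambient M) fun v => succ (g₁ v) :=
  DfnFun.comp₁ succ (by simp only [eq_succ_iff]; infer_instance)

instance dfn_isNat : Dfn (ambient M) fun v => IsNat (g₁ v) :=
  Dfn.comp₁ IsNat (by unfold IsNat; infer_instance)

instance dfn_isOmega : Dfn (ambient M) fun v => IsOmega (g₁ v) :=
  Dfn.comp₁ IsOmega (by unfold IsOmega; infer_instance)

instance dfn_app : Dfn (ambient M) fun v => App (g₁ v) (g₂ v) (g₃ v) :=
  Dfn.comp₃ App (by unfold App; infer_instance)

instance dfn_isFunction : Dfn (ambient M) fun v => IsFunction (g₁ v) (g₂ v) (g₃ v) :=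
  Dfn.comp₃ IsFunction (by unfold IsFunction; infer_instance)

instance dfnFun_eqCode : DfnFun (ambient M) fun v => eqCode (g₁ v) (g₂ v) :=
  inferInstanceAs (DfnFun (ambient M) fun v => opair (num 0) (opair (g₁ v) (g₂ v)))

instance dfnFun_memCode : DfnFun (ambient M) fun v => memCode (g₁ v) (g₂ v) :=
  inferInstanceAs (DfnFun (ambient M) fun v => opair (num 1) (opair (g₁ v) (g₂ v)))

instance dfnFun_negCode : DfnFun (ambient M) fun v => negCode (g₁ v) :=
  inferInstanceAs (DfnFun (ambient M) fun v => opair (num 2) (g₁ v))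

instance dfnFun_andCode : DfnFun (ambient M) fun v => andCode (g₁ v) (g₂ v) :=
  inferInstanceAs (DfnFun (ambient M) fun v => opair (num 3) (opair (g₁ v) (g₂ v)))

instance dfnFun_exCode : DfnFun (ambient M) fun v => exCode (g₁ v) (g₂ v) :=
  inferInstanceAs (DfnFun (ambient M) fun v => opair (num 4) (opair (g₁ v) (g₂ v)))

instance dfn_formulaClosed : Dfn (ambient M) fun v => FormulaClosed (g₁ v) :=
  Dfn.comp₁ FormulaClosed (by unfold FormulaClosed; infer_instance)

instance dfn_isFormula : Dfn (ambient M) fun v => IsFormula (g₁ v) :=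
  Dfn.comp₁ IsFormula (by unfold IsFormula; infer_instance)

instance dfn_isAssignment : Dfn (ambient M) fun v => IsAssignment (g₁ v) (g₂ v) :=
  Dfn.comp₂ IsAssignment (by unfold IsAssignment; infer_instance)

instance dfn_agreeOff : Dfn (ambient M) fun v => AgreeOff (g₁ v) (g₂ v) (g₃ v) :=
  Dfn.comp₃ AgreeOff (by unfold AgreeOff; infer_instance)

set_option synthInstance.maxHeartbeats 400000 in
set_option synthInstance.maxSize 2000 in
instance dfn_isTruthSet : Dfn (ambient M) fun v => IsTruthSet (g₁ v) (g₂ v) :=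
  Dfn.comp₂ IsTruthSet (by unfold IsTruthSet; infer_instance)

instance dfn_satisfies : Dfn (ambient M) fun v => Satisfies (g₁ v) (g₂ v) (g₃ v) :=
  Dfn.comp₃ Satisfies (by unfold Satisfies; infer_instance)

instance dfn_definableFrom : Dfn (ambient M) fun v => DefinableFrom (g₁ v) (g₂ v) (g₃ v) :=
  Dfn.comp₃ DefinableFrom (by unfold DefinableFrom; infer_instance)

theorem eq_shift_iff {y x : M} : y = shift x ↔ (IsNat x ∧ y = succ x) ∨ (¬ IsNat x ∧ y = x) := by
  unfold shift
  split_ifs with h <;> simp [h]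

instance dfnFun_shift : DfnFun (ambient M) fun v => shift (g₁ v) :=
  DfnFun.comp₁ shift (by simp only [eq_shift_iff]; infer_instance)

instance dfn_isTagZero : Dfn (ambient M) fun v => IsTagZero (g₁ v) (g₂ v) :=
  Dfn.comp₂ IsTagZero (by unfold IsTagZero; infer_instance)

instance dfn_isTagOne : Dfn (ambient M) fun v => IsTagOne (g₁ v) (g₂ v) :=
  Dfn.comp₂ IsTagOne (by unfold IsTagOne; infer_instance)

instance dfn_isQRPair : Dfn (ambient M) fun v => IsQRPair (g₁ v) (g₂ v) (g₃ v) :=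
  Dfn.comp₃ IsQRPair (by unfold IsQRPair; infer_instance)

end Instances

variable {M : Type u} [Membership M M] [IsZF M]

/-! ### Elementary set theory in `M` -/

theorem not_mem_self (x : M) : x ∉ x := by
  obtain ⟨y, hy, h⟩ := IsZF.foundation (upair x x) ⟨x, (mem_upair _ _ _).2 (Or.inl rfl)⟩
  obtain rfl : y = x := by simpa [mem_upair] using hy
  exact fun hx => h y hx ((mem_upair _ _ _).2 (Or.inl rfl))

theorem not_mem_cycle₂ {x y : M} (h : x ∈ y) : y ∉ x := by
  intro h'
  obtain ⟨z, hz, hz'⟩ := IsZF.foundation (upair x y) ⟨x, (mem_upair _ _ _).2 (Or.inl rfl)⟩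
  rcases (mem_upair _ _ _).1 hz with rfl | rfl
  · exact hz' y h' ((mem_upair _ _ _).2 (Or.inr rfl))
  · exact hz' x h ((mem_upair _ _ _).2 (Or.inl rfl))

theorem exists_union (x y : M) : ∃ w : M, ∀ z, z ∈ w ↔ z ∈ x ∨ z ∈ y := by
  obtain ⟨w, hw⟩ := IsZF.union (upair x y)
  exact ⟨w, fun z => by simp [hw, mem_upair]⟩

theorem not_mem_cycle₃ {x y z : M} (hxy : x ∈ y) (hyz : y ∈ z) : z ∉ x := by
  intro hzx
  obtain ⟨s, hs⟩ := exists_union (upair x y) (upair z z)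
  simp only [mem_upair] at hs
  obtain ⟨t, ht, ht'⟩ := IsZF.foundation s ⟨x, by simp [hs]⟩
  rcases (hs t).1 ht with (rfl | rfl) | h
  · exact ht' z hzx ((hs z).2 (by simp))
  · exact ht' x hxy ((hs x).2 (by simp))
  · obtain rfl : t = z := by simpa using h
    exact ht' y hyz ((hs y).2 (by simp))

theorem exists_minimal (P : M → Prop) [Dfn (ambient M) fun v : Fin 1 → M => P (v 0)] {A x : M}
    (hx : x ∈ A) (h : P x) : ∃ y, y ∈ A ∧ P y ∧ ∀ z, z ∈ y → z ∈ A → ¬ P z := by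
  obtain ⟨w, hw⟩ := exists_sep P A
  obtain ⟨y, hy, hy'⟩ := IsZF.foundation w ⟨x, (hw x).2 ⟨hx, h⟩⟩
  exact ⟨y, ((hw y).1 hy).1, ((hw y).1 hy).2, fun z hz hzA hP => hy' z hz ((hw z).2 ⟨hzA, hP⟩)⟩

theorem upair_self_inj {x y : M} (h : upair x x = upair y y) : x = y := by
  have : x ∈ upair y y := h ▸ (mem_upair x x x).2 (Or.inl rfl)
  simpa [mem_upair] using this

theorem upair_eq_left {x y z : M} (h : upair x y = upair x z) : y = z := by
  have h1 : y ∈ upair x z := h ▸ (mem_upair x y y).2 (Or.inr rfl)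
  have h2 : z ∈ upair x y := h ▸ (mem_upair x z z).2 (Or.inr rfl)
  rw [mem_upair] at h1 h2
  grind

theorem opair_inj {x y x' y' : M} : opair x y = opair x' y' ↔ x = x' ∧ y = y' := by
  refine ⟨fun h => ?_, fun ⟨h, h'⟩ => h ▸ h' ▸ rfl⟩
  obtain rfl : x = x' := by
    have h1 : upair x' x' ∈ opair x y := h ▸ (mem_upair _ _ _).2 (Or.inl rfl)
    have h2 : x ∈ upair x' x' := by
      rcases (mem_upair _ _ _).1 h1 with h | h <;> rw [h] <;> simp [mem_upair]
    simpa [mem_upair] using h2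
  exact ⟨rfl, upair_eq_left (upair_eq_left h)⟩

theorem isNat_empty : IsNat (empty : M) := fun _ h _ => h

theorem IsNat.succ {n : M} (h : IsNat n) : IsNat (succ n) := fun w h0 hs => hs _ (h w h0 hs)

theorem isNat_num : ∀ n : ℕ, IsNat (num n : M)
  | 0 => isNat_empty
  | n + 1 => (isNat_num n).succ

theorem exists_inductive : ∃ w : M, empty ∈ w ∧ ∀ x, x ∈ w → succ x ∈ w := by
  obtain ⟨w, ⟨e, he, he'⟩, hs⟩ := IsZF.infinity (M := M)
  refine ⟨w, ?_, fun x hx => ?_⟩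
  · obtain rfl : e = empty := ext fun z => iff_of_false (he' z) (not_mem_empty z)
    exact he
  · obtain ⟨y, hy, h⟩ := hs x hx
    rwa [eq_succ_iff.2 h] at hy

theorem exists_omega : ∃ w : M, IsOmega w := by
  obtain ⟨w, h0, hs⟩ := exists_inductive (M := M)
  obtain ⟨v, hv⟩ := exists_sep IsNat w
  exact ⟨v, fun n => ⟨fun h => ((hv n).1 h).2, fun h => (hv n).2 ⟨h w h0 hs, h⟩⟩⟩

theorem IsOmega.unique {w w' : M} (h : IsOmega w) (h' : IsOmega w') : w = w' :=
  ext fun n => (h n).trans (h' n).symm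

theorem num_mem_num {i k : ℕ} (h : i < k) : (num i : M) ∈ (num k : M) := by
  induction k with
  | zero => omega
  | succ k ih =>
    refine (mem_succ _ _).2 ?_
    rcases Nat.lt_succ_iff_lt_or_eq.1 h with h | rfl
    · exact Or.inl (ih h)
    · exact Or.inr rfl

theorem num_inj {i k : ℕ} : (num i : M) = num k ↔ i = k := by
  refine ⟨fun h => ?_, fun h => h ▸ rfl⟩
  by_contra hne
  rcases Nat.lt_or_gt_of_ne hne with hlt | hlt
  · exact not_mem_self (num k : M) (by simpa [h] using num_mem_num (M := M) hlt)
  · exact not_mem_self (num k : M) (by simpa [h] using num_mem_num (M := M) hlt)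

/-! ### Functions in `M` -/

theorem exists_product (A B : M) : ∃ w : M, ∀ x y, x ∈ A → y ∈ B → opair x y ∈ w := by
  obtain ⟨U, hU⟩ := exists_union A B
  obtain ⟨P, hP⟩ := IsZF.powerset U
  obtain ⟨Q, hQ⟩ := IsZF.powerset P
  refine ⟨Q, fun x y hx hy => (hQ _).2 fun z hz => (hP _).2 fun t ht => (hU t).2 ?_⟩
  rcases (mem_upair _ _ _).1 hz with rfl | rfl <;> rcases (mem_upair _ _ _).1 ht with rfl | rfl
  exacts [Or.inl hx, Or.inl hx, Or.inl hx, Or.inr hy]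

theorem exists_function (A B : M) (R : M → M → Prop)
    [Dfn (ambient M) fun v : Fin 2 → M => R (v 0) (v 1)]
    (h : ∀ x, x ∈ A → ∃! y, y ∈ B ∧ R x y) :
    ∃ f : M, IsFunction f A B ∧ ∀ x y, App f x y ↔ x ∈ A ∧ y ∈ B ∧ R x y := by
  obtain ⟨w, hw⟩ := exists_product A B
  have inst : Dfn (ambient M) fun v : Fin 3 → M => R (v 1) (v 2) :=
    Dfn.rename (P := fun v : Fin 2 → M => R (v 0) (v 1)) inferInstance ![1, 2]
  have inst' : Dfn (ambient M) fun v : Fin 3 → M => R (v 1) (v 0) :=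
    Dfn.rename (P := fun v : Fin 2 → M => R (v 0) (v 1)) inferInstance ![1, 0]
  obtain ⟨f, hf⟩ := exists_sep (fun p => ∃ x y, x ∈ A ∧ y ∈ B ∧ R x y ∧ p = opair x y)
    (h := Dfn.exists (h := Dfn.exists (h :=
      Dfn.and (h' := Dfn.and (h' := Dfn.and (h := inst'))))) ) w
  have happ : ∀ x y, App f x y ↔ x ∈ A ∧ y ∈ B ∧ R x y := fun x y => by
    unfold App
    rw [hf]
    constructor
    · rintro ⟨_, x', y', hx, hy, hR, he⟩
      obtain ⟨rfl, rfl⟩ := opair_inj.1 he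
      exact ⟨hx, hy, hR⟩
    · rintro ⟨hx, hy, hR⟩
      exact ⟨hw x y hx hy, x, y, hx, hy, hR, rfl⟩
  refine ⟨f, ⟨fun p hp => ?_, fun x hx => ?_⟩, happ⟩
  · obtain ⟨_, x, y, hx, hy, -, rfl⟩ := (hf p).1 hp
    exact ⟨x, y, hx, hy, rfl⟩
  · obtain ⟨y, hy, hy'⟩ := h x hx
    exact ⟨y, (happ x y).2 ⟨hx, hy⟩, fun z hz => hy' z ((happ x z).1 hz).2⟩

theorem IsFunction.mem {f A B x y : M} (h : IsFunction f A B) (hxy : App f x y) :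
    x ∈ A ∧ y ∈ B := by
  obtain ⟨x', y', hx, hy, he⟩ := h.1 _ hxy
  obtain ⟨rfl, rfl⟩ := opair_inj.1 he
  exact ⟨hx, hy⟩

theorem IsFunction.unique {f A B x y z : M} (h : IsFunction f A B) (hy : App f x y)
    (hz : App f x z) : y = z :=
  (h.2 x (h.mem hy).1).unique hy hz

theorem IsFunction.exists {f A B x : M} (h : IsFunction f A B) (hx : x ∈ A) : ∃ y, App f x y :=
  (h.2 x hx).exists

theorem IsFunction.ext {f g A B C : M} (hf : IsFunction f A B) (hg : IsFunction g A C)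
    (h : ∀ x y, App f x y → App g x y) : f = g := by
  refine ChoicelessZF.ext fun p => ⟨fun hp => ?_, fun hp => ?_⟩
  · obtain ⟨x, y, -, -, rfl⟩ := hf.1 p hp
    exact h x y hp
  · obtain ⟨x, y, hx, -, rfl⟩ := hg.1 p hp
    obtain ⟨y', hy'⟩ := hf.exists hx
    rwa [hg.unique hp (h x y' hy')]

theorem exists_update {f A B C i y : M} (hf : IsFunction f A B) (hB : ∀ z, z ∈ B → z ∈ C)
    (hy : y ∈ C) (hi : i ∈ A) : ∃ g : M, IsFunction g A C ∧ App g i y ∧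
      ∀ x z, x ≠ i → (App g x z ↔ App f x z) := by
  obtain ⟨g, hg, happ⟩ := exists_function A C (fun x z => (x = i ∧ z = y) ∨ (x ≠ i ∧ App f x z))
    (fun x hx => by
      by_cases hxi : x = i
      · exact ⟨y, ⟨hy, Or.inl ⟨hxi, rfl⟩⟩, fun z hz => by grind⟩
      · obtain ⟨z, hz⟩ := hf.exists hx
        refine ⟨z, ⟨hB z (hf.mem hz).2, Or.inr ⟨hxi, hz⟩⟩, fun z' hz' => ?_⟩
        rcases hz'.2 with h | h
        · exact absurd h.1 hxi
        · exact hf.unique h.2 hz)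
  refine ⟨g, hg, (happ i y).2 ⟨hi, hy, Or.inl ⟨rfl, rfl⟩⟩, fun x z hx => ?_⟩
  rw [happ]
  constructor
  · rintro ⟨-, -, h | h⟩
    · exact absurd h.1 hx
    · exact h.2
  · intro h
    exact ⟨(hf.mem h).1, hB z (hf.mem h).2, Or.inr ⟨hx, h⟩⟩

theorem exists_const {A B d : M} (hd : d ∈ B) :
    ∃ f : M, IsFunction f A B ∧ ∀ x, x ∈ A → App f x d := by
  obtain ⟨f, hf, happ⟩ := exists_function A B (fun _ y => y = d) fun x _ =>
    ⟨d, ⟨hd, rfl⟩, fun y hy => hy.2⟩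
  exact ⟨f, hf, fun x hx => (happ x d).2 ⟨hx, hd, rfl⟩⟩

theorem exists_comp {f g A B C : M} (hf : IsFunction f A B) (hg : IsFunction g B C) :
    ∃ h : M, IsFunction h A C ∧ ∀ x y z, App f x y → (App h x z ↔ App g y z) := by
  obtain ⟨h, hh, happ⟩ := exists_function A C (fun x z => ∃ y, App f x y ∧ App g y z) fun x hx => by
    obtain ⟨y, hy⟩ := hf.exists hx
    obtain ⟨z, hz⟩ := hg.exists (hf.mem hy).2
    refine ⟨z, ⟨(hg.mem hz).2, y, hy, hz⟩, ?_⟩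
    rintro z' ⟨-, y', hy', hz'⟩
    rw [hf.unique hy' hy] at hz'
    exact hg.unique hz' hz
  refine ⟨h, hh, fun x y z hxy => ?_⟩
  rw [happ]
  constructor
  · rintro ⟨-, -, y', hy', hz'⟩
    rwa [hf.unique hxy hy']
  · intro hz
    exact ⟨(hf.mem hxy).1, (hg.mem hz).2, y, hxy, hz⟩

/-- A function on `ω` with prescribed values at finitely many standard arguments, and a constant
value elsewhere. -/
theorem exists_table {w B d : M} (hw : IsOmega w) (hd : d ∈ B) :
    ∀ {n : ℕ} (v : Fin n → M), (∀ i, v i ∈ B) → ∃ s : M, IsFunction s w B ∧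
      (∀ i : Fin n, App s (num i) (v i)) ∧ ∀ k, IsNat k → (∀ i : Fin n, k ≠ num i) → App s k d
  | 0, _, _ => by
    obtain ⟨s, hs, h⟩ := exists_const (A := w) hd
    exact ⟨s, hs, fun i => i.elim0, fun k hk _ => h k ((hw k).2 hk)⟩
  | n + 1, v, hv => by
    obtain ⟨s, hs, h1, h2⟩ := exists_table hw hd (fun i : Fin n => v i.castSucc) fun i => hv _
    obtain ⟨t, ht, h3, h4⟩ := exists_update hs (fun _ h => h) (hv (Fin.last n))
      ((hw _).2 (isNat_num n))
    refine ⟨t, ht, fun i => ?_, fun k hk hne => ?_⟩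
    · refine Fin.lastCases h3 (fun i => ?_) i
      refine (h4 _ _ ?_).2 (h1 i)
      rw [Fin.val_castSucc, Ne, num_inj]
      exact i.2.ne
    · exact (h4 _ _ (hne (Fin.last n))).2 (h2 k hk fun i => hne i.castSucc)

theorem IsNat.mem {n m : M} (hn : IsNat n) (hm : m ∈ n) : IsNat m := by
  obtain ⟨w, hw⟩ := exists_omega (M := M)
  obtain ⟨v, hv⟩ := exists_sep (fun n => ∀ m, m ∈ n → m ∈ w) w
  refine (hw m).1 (((hv n).1 (hn v ?_ ?_)).2 m hm)
  · exact (hv _).2 ⟨(hw _).2 isNat_empty, fun m hm => absurd hm (not_mem_empty m)⟩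
  · intro x hx
    obtain ⟨hxw, hx⟩ := (hv x).1 hx
    refine (hv _).2 ⟨(hw _).2 ((hw x).1 hxw).succ, fun m hm => ?_⟩
    rcases (mem_succ _ _).1 hm with h | rfl
    exacts [hx m h, hxw]

theorem IsFunction.mono {f A B C : M} (hf : IsFunction f A B) (h : ∀ z, z ∈ B → z ∈ C) :
    IsFunction f A C :=
  ⟨fun p hp => by
    obtain ⟨x, y, hx, hy, he⟩ := hf.1 p hp
    exact ⟨x, y, hx, h y hy, he⟩, hf.2⟩

/-! ### Induction on formulas and Tarski's clauses -/

theorem isFormula_eqCode {i k : M} (hi : IsNat i) (hk : IsNat k) : IsFormula (eqCode i k) :=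
  fun _ hF => (hF.1 i k hi hk).1

theorem isFormula_memCode {i k : M} (hi : IsNat i) (hk : IsNat k) : IsFormula (memCode i k) :=
  fun _ hF => (hF.1 i k hi hk).2

theorem IsFormula.neg {φ : M} (h : IsFormula φ) : IsFormula (negCode φ) :=
  fun F hF => hF.2.1 _ (h F hF)

theorem IsFormula.and {φ ψ : M} (h : IsFormula φ) (h' : IsFormula ψ) : IsFormula (andCode φ ψ) :=
  fun F hF => hF.2.2.1 _ _ (h F hF) (h' F hF)

theorem IsFormula.ex {i φ : M} (hi : IsNat i) (h : IsFormula φ) : IsFormula (exCode i φ) :=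
  fun F hF => hF.2.2.2 _ _ hi (h F hF)

/-- The structure `(V, ∈)` is nonempty and has a truth predicate in `M`. -/
class HasTruth (V : M) : Prop where
  truth : ∃ T, IsTruthSet V T
  nonempty : ∃ d, d ∈ V

theorem exists_assignment {V d : M} (hd : d ∈ V) : ∃ s, IsAssignment V s := by
  obtain ⟨w, hw⟩ := exists_omega (M := M)
  obtain ⟨s, hs, -⟩ := exists_const (A := w) hd
  exact ⟨s, w, hw, hs⟩

/-- A truth set bounds the class of formulas: for a fixed assignment `s`, either `φ` or its negation
is paired with `s` in `T`, so `φ` occurs in an iterated union of `T`. Separation then yields the set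
of formulas without any recursion on `ω`. -/
theorem exists_formulaSet (V : M) [hV : HasTruth V] : ∃ F : M, ∀ φ, φ ∈ F ↔ IsFormula φ := by
  obtain ⟨T, hT⟩ := hV.truth
  obtain ⟨d, hd⟩ := hV.nonempty
  obtain ⟨s, hs⟩ := exists_assignment hd
  have hfst : ∀ t : M, ∃ w : M, ∀ x y : M, opair x y ∈ t → x ∈ w ∧ y ∈ w := fun t => by
    obtain ⟨u, hu⟩ := IsZF.union t
    obtain ⟨w, hw⟩ := IsZF.union u
    have key : ∀ x y : M, opair x y ∈ t → upair x y ∈ u :=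
      fun x y h => (hu _).2 ⟨_, h, (mem_upair _ _ _).2 (Or.inr rfl)⟩
    exact ⟨w, fun x y h => ⟨(hw x).2 ⟨_, key x y h, (mem_upair _ _ _).2 (Or.inl rfl)⟩,
      (hw y).2 ⟨_, key x y h, (mem_upair _ _ _).2 (Or.inr rfl)⟩⟩⟩
  obtain ⟨w, hw⟩ := hfst T
  obtain ⟨w', hw'⟩ := hfst w
  obtain ⟨U, hU⟩ := exists_union w w'
  obtain ⟨F, hF⟩ := exists_sep IsFormula U
  refine ⟨F, fun φ => ⟨fun h => ((hF φ).1 h).2, fun h => (hF φ).2 ⟨(hU φ).2 ?_, h⟩⟩⟩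
  by_cases hφ : opair φ s ∈ T
  · exact Or.inl (hw _ _ hφ).1
  · exact Or.inr (hw' _ _ (hw _ _ (((hT s hs).2.2.1 φ h).2 hφ)).1).2

theorem formula_induction (V : M) [HasTruth V] (P : M → Prop)
    [Dfn (ambient M) fun v : Fin 1 → M => P (v 0)]
    (heq : ∀ i k, IsNat i → IsNat k → P (eqCode i k))
    (hmem : ∀ i k, IsNat i → IsNat k → P (memCode i k))
    (hneg : ∀ φ, IsFormula φ → P φ → P (negCode φ))
    (hand : ∀ φ ψ, IsFormula φ → IsFormula ψ → P φ → P ψ → P (andCode φ ψ))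
    (hex : ∀ i φ, IsNat i → IsFormula φ → P φ → P (exCode i φ)) {φ : M} (hφ : IsFormula φ) :
    P φ := by
  obtain ⟨F, hF⟩ := exists_formulaSet V
  obtain ⟨G, hG⟩ := exists_sep P F
  simp only [hF] at hG
  refine ((hG φ).1 (hφ G ⟨fun i k hi hk => ⟨?_, ?_⟩, fun φ h => ?_, fun φ ψ h h' => ?_,
    fun i φ hi h => ?_⟩)).2
  · exact (hG _).2 ⟨isFormula_eqCode hi hk, heq i k hi hk⟩
  · exact (hG _).2 ⟨isFormula_memCode hi hk, hmem i k hi hk⟩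
  · rw [hG] at h ⊢
    exact ⟨h.1.neg, hneg φ h.1 h.2⟩
  · rw [hG] at h h' ⊢
    exact ⟨h.1.and h'.1, hand φ ψ h.1 h'.1 h.2 h'.2⟩
  · rw [hG] at h ⊢
    exact ⟨h.1.ex hi, hex i φ hi h.1 h.2⟩

section Truth

variable {V : M} [hV : HasTruth V]

theorem IsTruthSet.unique {T T' φ : M} (hT : IsTruthSet V T) (hT' : IsTruthSet V T')
    (hφ : IsFormula φ) : ∀ s, IsAssignment V s → (opair φ s ∈ T ↔ opair φ s ∈ T') := by
  refine formula_induction V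
    (fun φ => ∀ s, IsAssignment V s → (opair φ s ∈ T ↔ opair φ s ∈ T'))
    (fun i k hi hk s hs => ?_) (fun i k hi hk s hs => ?_) (fun φ hφ ih s hs => ?_)
    (fun φ ψ hφ hψ ih ih' s hs => ?_) (fun i φ hi hφ ih s hs => ?_) hφ
  · rw [(hT s hs).1 i k hi hk, (hT' s hs).1 i k hi hk]
  · rw [(hT s hs).2.1 i k hi hk, (hT' s hs).2.1 i k hi hk]
  · rw [(hT s hs).2.2.1 φ hφ, (hT' s hs).2.2.1 φ hφ, ih s hs]
  · rw [(hT s hs).2.2.2.1 φ ψ hφ hψ, (hT' s hs).2.2.2.1 φ ψ hφ hψ, ih s hs, ih' s hs]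
  · rw [(hT s hs).2.2.2.2 i φ hi hφ, (hT' s hs).2.2.2.2 i φ hi hφ]
    exact exists_congr fun t => and_congr_right fun ht => and_congr_right fun _ => ih t ht

theorem IsTruthSet.satisfies_iff {T φ s : M} (hT : IsTruthSet V T) (hφ : IsFormula φ)
    (hs : IsAssignment V s) : Satisfies V φ s ↔ opair φ s ∈ T :=
  ⟨fun ⟨_, hT', h⟩ => (hT'.unique hT hφ s hs).1 h, fun h => ⟨T, hT, h⟩⟩

theorem satisfies_eqCode {s i k : M} (hs : IsAssignment V s) (hi : IsNat i) (hk : IsNat k) :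
    Satisfies V (eqCode i k) s ↔ ∃ y, App s i y ∧ App s k y := by
  obtain ⟨T, hT⟩ := hV.truth
  rw [hT.satisfies_iff (isFormula_eqCode hi hk) hs, (hT s hs).1 i k hi hk]

theorem satisfies_memCode {s i k : M} (hs : IsAssignment V s) (hi : IsNat i) (hk : IsNat k) :
    Satisfies V (memCode i k) s ↔ ∃ y z, App s i y ∧ App s k z ∧ y ∈ z := by
  obtain ⟨T, hT⟩ := hV.truth
  rw [hT.satisfies_iff (isFormula_memCode hi hk) hs, (hT s hs).2.1 i k hi hk]

theorem satisfies_negCode {s φ : M} (hs : IsAssignment V s) (hφ : IsFormula φ) :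
    Satisfies V (negCode φ) s ↔ ¬ Satisfies V φ s := by
  obtain ⟨T, hT⟩ := hV.truth
  rw [hT.satisfies_iff hφ.neg hs, hT.satisfies_iff hφ hs, (hT s hs).2.2.1 φ hφ]

theorem satisfies_andCode {s φ ψ : M} (hs : IsAssignment V s) (hφ : IsFormula φ)
    (hψ : IsFormula ψ) :
    Satisfies V (andCode φ ψ) s ↔ Satisfies V φ s ∧ Satisfies V ψ s := by
  obtain ⟨T, hT⟩ := hV.truth
  rw [hT.satisfies_iff (hφ.and hψ) hs, hT.satisfies_iff hφ hs, hT.satisfies_iff hψ hs,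
    (hT s hs).2.2.2.1 φ ψ hφ hψ]

theorem satisfies_exCode {s i φ : M} (hs : IsAssignment V s) (hi : IsNat i) (hφ : IsFormula φ) :
    Satisfies V (exCode i φ) s ↔
      ∃ t, IsAssignment V t ∧ AgreeOff i s t ∧ Satisfies V φ t := by
  obtain ⟨T, hT⟩ := hV.truth
  rw [hT.satisfies_iff (hφ.ex hi) hs, (hT s hs).2.2.2.2 i φ hi hφ]
  exact exists_congr fun t => and_congr_right fun ht => and_congr_right fun _ =>
    (hT.satisfies_iff hφ ht).symm

end Truth

/-! ### Assignments -/

theorem IsAssignment.isFunction {V s w : M} (hs : IsAssignment V s) (hw : IsOmega w) :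
    IsFunction s w V := by
  obtain ⟨w', hw', h⟩ := hs
  rwa [hw'.unique hw] at h

theorem IsAssignment.exists {V s i : M} (hs : IsAssignment V s) (hi : IsNat i) :
    ∃ y, y ∈ V ∧ App s i y := by
  obtain ⟨w, hw, h⟩ := hs
  obtain ⟨y, hy⟩ := h.exists ((hw i).2 hi)
  exact ⟨y, (h.mem hy).2, hy⟩

theorem IsAssignment.unique {V s i y z : M} (hs : IsAssignment V s) (hy : App s i y)
    (hz : App s i z) : y = z := by
  obtain ⟨w, -, h⟩ := hs
  exact h.unique hy hz

theorem IsAssignment.update {V s i y : M} (hs : IsAssignment V s) (hi : IsNat i) (hy : y ∈ V) :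
    ∃ t, IsAssignment V t ∧ App t i y ∧ ∀ k z, k ≠ i → (App t k z ↔ App s k z) := by
  obtain ⟨w, hw, h⟩ := hs
  obtain ⟨t, ht, h'⟩ := exists_update h (fun _ h => h) hy ((hw i).2 hi)
  exact ⟨t, ⟨w, hw, ht⟩, h'⟩

/-! ### Substitution of variables -/

/-- The assignment `t` is the composition of `s` with the map `r` of variables. -/
def IsReindex (r s t : M) : Prop := ∀ i m y, App r i m → (App t i y ↔ App s m y)

instance dfn_isReindex {n : ℕ} {g₁ g₂ g₃ : (Fin n → M) → M} [DfnFun (ambient M) g₁]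
    [DfnFun (ambient M) g₂] [DfnFun (ambient M) g₃] :
    Dfn (ambient M) fun v => IsReindex (g₁ v) (g₂ v) (g₃ v) :=
  Dfn.comp₃ IsReindex (by unfold IsReindex; infer_instance)

/-- Variables of `φ` are renamed along `r`, by induction on `φ` for all `r` at once. The range of
`r` is bounded by a natural number so that a fresh variable is always at hand. -/
theorem exists_substitution {V w : M} [HasTruth V] (hw : IsOmega w) {φ : M} (hφ : IsFormula φ) :
    ∀ N r, IsNat N → IsFunction r w N → ∃ ψ, IsFormula ψ ∧ ∀ s t, IsAssignment V s →
      IsAssignment V t → IsReindex r s t → (Satisfies V ψ s ↔ Satisfies V φ t) := by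
  refine formula_induction V (fun φ => ∀ N r, IsNat N → IsFunction r w N → ∃ ψ, IsFormula ψ ∧
    ∀ s t, IsAssignment V s → IsAssignment V t → IsReindex r s t →
      (Satisfies V ψ s ↔ Satisfies V φ t))
    (fun i k hi hk N r hN hr => ?_) (fun i k hi hk N r hN hr => ?_) (fun φ hφ ih N r hN hr => ?_)
    (fun φ ψ hφ hψ ih ih' N r hN hr => ?_) (fun i φ hi hφ ih N r hN hr => ?_) hφ
  · obtain ⟨i', hi'⟩ := hr.exists ((hw i).2 hi)
    obtain ⟨k', hk'⟩ := hr.exists ((hw k).2 hk)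
    have hin := hN.mem (hr.mem hi').2
    have hkn := hN.mem (hr.mem hk').2
    refine ⟨_, isFormula_eqCode hin hkn, fun s t hs ht hst => ?_⟩
    rw [satisfies_eqCode hs hin hkn, satisfies_eqCode ht hi hk]
    simp only [hst i i' _ hi', hst k k' _ hk']
  · obtain ⟨i', hi'⟩ := hr.exists ((hw i).2 hi)
    obtain ⟨k', hk'⟩ := hr.exists ((hw k).2 hk)
    have hin := hN.mem (hr.mem hi').2
    have hkn := hN.mem (hr.mem hk').2
    refine ⟨_, isFormula_memCode hin hkn, fun s t hs ht hst => ?_⟩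
    rw [satisfies_memCode hs hin hkn, satisfies_memCode ht hi hk]
    simp only [hst i i' _ hi', hst k k' _ hk']
  · obtain ⟨ψ, hψ, h⟩ := ih N r hN hr
    refine ⟨_, hψ.neg, fun s t hs ht hst => ?_⟩
    rw [satisfies_negCode hs hψ, satisfies_negCode ht hφ, h s t hs ht hst]
  · obtain ⟨φ', hφ', h⟩ := ih N r hN hr
    obtain ⟨ψ', hψ', h'⟩ := ih' N r hN hr
    refine ⟨_, hφ'.and hψ', fun s t hs ht hst => ?_⟩
    rw [satisfies_andCode hs hφ' hψ', satisfies_andCode ht hφ hψ, h s t hs ht hst,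
      h' s t hs ht hst]
  -- The variable `v_N` is fresh because `r` takes values below `N`. The bound variable `v_i` is
  -- renamed to it, and the bound grows to `N + 1`.
  · obtain ⟨r', hr', hri, hrk⟩ := exists_update hr (C := succ N)
      (fun z hz => (mem_succ _ _).2 (Or.inl hz)) ((mem_succ N N).2 (Or.inr rfl)) ((hw i).2 hi)
    obtain ⟨ψ, hψ, h⟩ := ih _ r' hN.succ hr'
    have hne : ∀ k m, App r k m → IsNat m ∧ m ≠ N := fun k m hkm =>
      ⟨hN.mem (hr.mem hkm).2, fun he => not_mem_self N (he ▸ (hr.mem hkm).2)⟩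
    refine ⟨_, hψ.ex hN, fun s t hs ht hst => ?_⟩
    rw [satisfies_exCode hs hN hψ, satisfies_exCode ht hi hφ]
    constructor
    · rintro ⟨s', hs', hss', hsat⟩
      obtain ⟨y, hy, hsy⟩ := hs'.exists hN
      obtain ⟨t', ht', hty, htk⟩ := ht.update hi hy
      refine ⟨t', ht', fun k _ hk y => (htk k y hk).symm, (h s' t' hs' ht' ?_).1 hsat⟩
      intro k m z hkm
      by_cases hk : k = i
      · subst hk
        rw [hr'.unique hkm hri]
        exact ⟨fun hz => ht'.unique hty hz ▸ hsy, fun hz => hs'.unique hsy hz ▸ hty⟩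
      · rw [hrk k m hk] at hkm
        rw [htk k z hk, hst k m z hkm]
        exact hss' m (hne k m hkm).1 (hne k m hkm).2 z
    · rintro ⟨t', ht', htt', hsat⟩
      obtain ⟨y, hy, hty⟩ := ht'.exists hi
      obtain ⟨s', hs', hsy, hsk⟩ := hs.update hN hy
      refine ⟨s', hs', fun k _ hk y => (hsk k y hk).symm, (h s' t' hs' ht' ?_).2 hsat⟩
      intro k m z hkm
      by_cases hk : k = i
      · subst hk
        rw [hr'.unique hkm hri]
        exact ⟨fun hz => ht'.unique hty hz ▸ hsy, fun hz => hs'.unique hsy hz ▸ hty⟩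
      · have hkw := (hw k).1 (hr'.mem hkm).1
        rw [hrk k m hk] at hkm
        rw [hsk m z (hne k m hkm).2, ← hst k m z hkm]
        exact (htt' k hkw hk z).symm

theorem exists_reindex {V r s w N : M} (hw : IsOmega w) (hN : IsNat N) (hr : IsFunction r w N)
    (hs : IsAssignment V s) : ∃ t, IsAssignment V t ∧ IsReindex r s t := by
  obtain ⟨t, ht, h⟩ := exists_comp (hr.mono fun z hz => (hw z).2 (hN.mem hz)) (hs.isFunction hw)
  exact ⟨t, ⟨w, hw, ht⟩, fun i m y him => h i m y him⟩

/-! ### The structure `(V, ∈)` seen from outside -/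

/-- The elements of `V`, as a type. -/
def Carrier (V : M) : Type u := {x : M // x ∈ V}

instance (V : M) : Membership (Carrier V) (Carrier V) := ⟨fun y x => x.1 ∈ y.1⟩

/-- The predicate `P` is expressed over `(V, ∈)` by the formula `φ` of `M`. -/
def Expresses (V φ : M) {n : ℕ} (P : (Fin n → Carrier V) → Prop) : Prop :=
  IsFormula φ ∧ ∀ s, IsAssignment V s → ∀ v : Fin n → Carrier V,
    (∀ i : Fin n, App s (num i) (v i).1) →
    (Satisfies V φ s ↔ P v)

theorem expresses_rename {V : M} [HasTruth V] {m n : ℕ} (ρ : Fin m → Fin n)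
    {P : (Fin m → Carrier V) → Prop} {φ : M} (h : Expresses V φ P) :
    ∃ ψ, Expresses V ψ fun v : Fin n → Carrier V => P fun i => v (ρ i) := by
  obtain ⟨w, hw⟩ := exists_omega (M := M)
  -- The bound is `n + 1` so that the default value `0` is below it even when `n = 0`.
  obtain ⟨r, hr, hρ, -⟩ := exists_table hw (B := num (n + 1)) (d := (num 0 : M))
    (num_mem_num n.succ_pos) (fun i => num (ρ i))
    fun i => num_mem_num ((ρ i).2.trans n.lt_succ_self)
  obtain ⟨ψ, hψ, hsat⟩ := exists_substitution (V := V) hw h.1 _ r (isNat_num _) hr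
  refine ⟨ψ, hψ, fun s hs v hv => ?_⟩
  obtain ⟨t, ht, hst⟩ := exists_reindex hw (isNat_num _) hr hs
  beta_reduce
  rw [hsat s t hs ht hst]
  exact h.2 t ht _ fun i => (hst _ _ _ (hρ i)).2 (hv (ρ i))

theorem expresses_ex {V : M} [HasTruth V] {n : ℕ} {P : (Fin (n + 1) → Carrier V) → Prop} {φ : M}
    (h : Expresses V φ P) :
    ∃ ψ, Expresses V ψ fun v : Fin n → Carrier V => ∃ x, P (Fin.cons x v) := by
  -- The quantified coordinate comes first in `Fin.cons`. Moving it to the end lets the free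
  -- variables keep their numbers, and `v_n` is the one to bind.
  obtain ⟨ψ, hψ⟩ := expresses_rename (Fin.cases (Fin.last n) fun i => i.castSucc) h
  refine ⟨exCode (num n) ψ, hψ.1.ex (isNat_num n), fun s hs v hv => ?_⟩
  beta_reduce
  rw [satisfies_exCode hs (isNat_num n) hψ.1]
  have key : ∀ (t : M) (x : Carrier V), IsAssignment V t → AgreeOff (num n) s t →
      App t (num n) x.1 → (Satisfies V ψ t ↔ P (Fin.cons x v)) := fun t x ht hst htx => by
    rw [hψ.2 t ht (Fin.snoc v x) fun i => ?_]
    · refine iff_of_eq (congrArg P (funext fun i => ?_))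
      refine Fin.cases ?_ (fun i => ?_) i <;> simp
    · refine Fin.lastCases ?_ (fun i => ?_) i
      · simpa using htx
      · rw [Fin.snoc_castSucc]
        refine (hst _ (isNat_num _) ?_ _).1 (hv i)
        rw [Fin.val_castSucc, Ne, num_inj]
        exact i.2.ne
  constructor
  · rintro ⟨t, ht, hst, hsat⟩
    obtain ⟨y, hy, hty⟩ := ht.exists (isNat_num n)
    exact ⟨⟨y, hy⟩, (key t ⟨y, hy⟩ ht hst hty).1 hsat⟩
  · rintro ⟨x, hx⟩
    obtain ⟨t, ht, htx, htk⟩ := hs.update (isNat_num n) x.2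
    have hst : AgreeOff (num n) s t := fun k _ hk y => (htk k y hk).symm
    exact ⟨t, ht, hst, (key t x ht hst htx).2 hx⟩

/-- The family of predicates on `(V, ∈)` that are expressed by formulas of `M`. -/
def inner (V : M) [HasTruth V] : FODef (Carrier V) where
  Holds := fun {_} P => ∃ φ, Expresses V φ P
  mem := fun i k => ⟨_, isFormula_memCode (isNat_num i) (isNat_num k), fun s hs v hv => by
    rw [satisfies_memCode hs (isNat_num i) (isNat_num k)]
    constructor
    · rintro ⟨y, z, hy, hz, h⟩
      rw [hs.unique hy (hv i), hs.unique hz (hv k)] at h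
      exact h
    · intro h
      exact ⟨_, _, hv i, hv k, h⟩⟩
  eq := fun i k => ⟨_, isFormula_eqCode (isNat_num i) (isNat_num k), fun s hs v hv => by
    rw [satisfies_eqCode hs (isNat_num i) (isNat_num k)]
    constructor
    · rintro ⟨y, hy, hy'⟩
      exact Subtype.ext ((hs.unique (hv i) hy).trans (hs.unique hy' (hv k)))
    · intro h
      exact ⟨_, hv i, h ▸ hv k⟩⟩
  not := fun ⟨φ, h⟩ => ⟨_, h.1.neg, fun s hs v hv => by
    rw [satisfies_negCode hs h.1, h.2 s hs v hv]⟩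
  and := fun ⟨φ, h⟩ ⟨ψ, h'⟩ => ⟨_, h.1.and h'.1, fun s hs v hv => by
    rw [satisfies_andCode hs h.1 h'.1, h.2 s hs v hv, h'.2 s hs v hv]⟩
  ex := fun ⟨_, h⟩ => expresses_ex h
  rename := fun {_ _} ρ {_} ⟨_, h⟩ => expresses_rename ρ h

/-- `s` assigns `v i` to the `i`th variable for `i < n`, and `d` to all other variables. -/
def IsTuple {n : ℕ} (v : Fin n → M) (d s : M) : Prop :=
  (∀ i : Fin n, App s (num i) (v i)) ∧ ∀ k, IsNat k → (∀ i : Fin n, k ≠ num i) → App s k d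

theorem exists_isTuple {V d : M} {n : ℕ} {v : Fin n → M} (hv : ∀ i, v i ∈ V) (hd : d ∈ V) :
    ∃ s, IsAssignment V s ∧ IsTuple v d s := by
  obtain ⟨w, hw⟩ := exists_omega (M := M)
  obtain ⟨s, hs, h⟩ := exists_table hw hd v hv
  exact ⟨s, ⟨w, hw, hs⟩, h⟩

theorem IsTuple.unique {V d s t : M} {n : ℕ} {v : Fin n → M} (hs : IsAssignment V s)
    (ht : IsAssignment V t) (h : IsTuple v d s) (h' : IsTuple v d t) : s = t := by
  obtain ⟨w, hw⟩ := exists_omega (M := M)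
  refine (hs.isFunction hw).ext (ht.isFunction hw) fun k y hk => ?_
  by_cases hkn : ∃ i : Fin n, k = num i
  · obtain ⟨i, rfl⟩ := hkn
    exact hs.unique (h.1 i) hk ▸ h'.1 i
  · push Not at hkn
    have hkN := (hw k).1 ((hs.isFunction hw).mem hk).1
    exact hs.unique (h.2 k hkN hkn) hk ▸ h'.2 k hkN hkn

/-- The formula `φ` holds in `(V, ∈)` when the `i`th variable has value `v i` for `i < n` and all
other variables have value `d`. -/
def Sat (V φ : M) {n : ℕ} (v : Fin n → Carrier V) (d : Carrier V) : Prop :=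
  ∃ s, IsAssignment V s ∧ IsTuple (fun i => (v i).1) d.1 s ∧ Satisfies V φ s

theorem sat_iff {V φ s : M} {n : ℕ} {v : Fin n → Carrier V} {d : Carrier V}
    (hs : IsAssignment V s) (h : IsTuple (fun i => (v i).1) d.1 s) :
    Sat V φ v d ↔ Satisfies V φ s := by
  constructor
  · rintro ⟨t, ht, h', hsat⟩
    rwa [IsTuple.unique hs ht h h']
  · intro hsat
    exact ⟨s, hs, h, hsat⟩

/-- A formula of `M` may have variables of arbitrary, even nonstandard, index. Sending all variables
from `v_n` on to `v_n` turns it into a predicate of `n + 1` arguments. -/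
theorem dfn_sat {V : M} [HasTruth V] {φ : M} (hφ : IsFormula φ) (n : ℕ) :
    Dfn (inner V) fun v : Fin (n + 1) → Carrier V =>
      Sat V φ (fun i => v i.castSucc) (v (Fin.last n)) := by
  obtain ⟨w, hw⟩ := exists_omega (M := M)
  obtain ⟨r, hr, hρ, hd⟩ := exists_table hw (B := num (n + 1)) (d := (num n : M))
    (num_mem_num n.lt_succ_self) (fun i : Fin n => num i)
    fun i => num_mem_num (i.2.trans n.lt_succ_self)
  obtain ⟨ψ, hψ, hsat⟩ := exists_substitution (V := V) hw hφ _ r (isNat_num _) hr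
  refine ⟨ψ, hψ, fun s hs v hv => ?_⟩
  obtain ⟨t, ht, hst⟩ := exists_reindex hw (isNat_num _) hr hs
  beta_reduce
  rw [hsat s t hs ht hst, sat_iff ht]
  exact ⟨fun i => (hst _ _ _ (hρ i)).2 (hv i.castSucc),
    fun k hk hne => (hst _ _ _ (hd k hk hne)).2 (hv (Fin.last n))⟩

/-! ### The levels of the cumulative hierarchy -/

/-- `f` is the function `β ↦ V_β` on `α + 1`, and `V = V_α`. -/
structure IsHierarchy (α V f : M) : Prop where
  ordinal : IsOrdinal α
  function : ∃ B, IsFunction f (succ α) B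
  recursion : ∀ β u, App f β u →
    ∀ x, x ∈ u ↔ ∃ γ t, γ ∈ β ∧ App f γ t ∧ ∀ z, z ∈ x → z ∈ t
  top : App f α V

theorem IsVonNeumann.exists_hierarchy {α V : M} (h : IsVonNeumann α V) :
    ∃ f, IsHierarchy α V f := by
  obtain ⟨hα, f, B, hf, hrec, htop⟩ := h
  exact ⟨f, hα, ⟨B, hf⟩, hrec, htop⟩

namespace IsHierarchy

variable {α V f : M} (h : IsHierarchy α V f) {β γ δ s t x y : M}
include h

theorem exists_level (hγ : γ ∈ α) : ∃ t, App f γ t := by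
  obtain ⟨B, hB⟩ := h.function
  exact hB.exists ((mem_succ _ _).2 (Or.inl hγ))

theorem index_mem (hγ : App f γ t) : γ ∈ α ∨ γ = α := by
  obtain ⟨B, hB⟩ := h.function
  exact (mem_succ _ _).1 (hB.mem hγ).1

theorem level_unique (hs : App f γ s) (ht : App f γ t) : s = t := by
  obtain ⟨B, hB⟩ := h.function
  exact hB.unique hs ht

/-- Elements of an ordinal are transitive: comparability leaves only membership cycles of length two
or three as alternatives, and foundation excludes these. -/
theorem index_trans (hγ : App f γ t) (hβ : β ∈ γ) (hδ : δ ∈ β) : δ ∈ γ := by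
  rcases h.index_mem hγ with hγα | rfl
  · have hβα := h.ordinal.1 _ _ hγα hβ
    rcases h.ordinal.2 _ _ (h.ordinal.1 _ _ hβα hδ) hγα with h' | rfl | h'
    · exact h'
    · exact absurd hδ (not_mem_cycle₂ hβ)
    · exact absurd h' (not_mem_cycle₃ hδ hβ)
  · exact h.ordinal.1 _ _ hβ hδ

theorem level_subset (hδ : δ ∈ γ) (hs : App f δ s) (ht : App f γ t) (hx : x ∈ s) : x ∈ t := by
  obtain ⟨ε, u, hε, hu, hxu⟩ := (h.recursion δ s hs x).1 hx
  exact (h.recursion γ t ht x).2 ⟨ε, u, h.index_trans ht hδ hε, hu, hxu⟩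

theorem mem_level (hδ : δ ∈ γ) (hs : App f δ s) (ht : App f γ t) (hx : ∀ z, z ∈ x → z ∈ s) :
    x ∈ t :=
  (h.recursion γ t ht x).2 ⟨δ, s, hδ, hs, hx⟩

theorem index_lt (ht : App f γ t) (hδ : δ ∈ γ) : δ ∈ α := by
  rcases h.index_mem ht with hγα | rfl
  · exact h.ordinal.1 _ _ hγα hδ
  · exact hδ

theorem level_trans (ht : App f γ t) (hx : x ∈ t) (hy : y ∈ x) : y ∈ t := by
  obtain ⟨δ, s, hδ, hs, hxs⟩ := (h.recursion γ t ht x).1 hx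
  exact h.level_subset hδ hs ht (hxs y hy)

theorem level_swelled (ht : App f γ t) (hx : x ∈ t) (hy : ∀ z, z ∈ y → z ∈ x) : y ∈ t := by
  obtain ⟨δ, s, hδ, hs, hxs⟩ := (h.recursion γ t ht x).1 hx
  exact h.mem_level hδ hs ht fun z hz => hxs z (hy z hz)

/-- Any two sets in levels below `γ` are included in a common level below `γ`. -/
theorem exists_common_level (ht : App f γ t) (hx : x ∈ t) (hy : y ∈ t) :
    ∃ δ s, δ ∈ γ ∧ App f δ s ∧ (∀ z, z ∈ x → z ∈ s) ∧ ∀ z, z ∈ y → z ∈ s := by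
  obtain ⟨δ, s, hδ, hs, hxs⟩ := (h.recursion γ t ht x).1 hx
  obtain ⟨ε, u, hε, hu, hyu⟩ := (h.recursion γ t ht y).1 hy
  rcases h.ordinal.2 _ _ (h.index_lt ht hδ) (h.index_lt ht hε) with hlt | rfl | hlt
  · exact ⟨ε, u, hε, hu, fun z hz => h.level_subset hlt hs hu (hxs z hz), hyu⟩
  · exact ⟨δ, s, hδ, hs, hxs, fun z hz => h.level_unique hu hs ▸ hyu z hz⟩
  · exact ⟨δ, s, hδ, hs, hxs, fun z hz => h.level_subset hlt hu hs (hyu z hz)⟩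

end IsHierarchy

/-! ### Maps that preserve formulas with finitely many parameters -/

/-- The relation `k` preserves the formula `φ` under assignments that are constant outside of the
first four variables. -/
def PreservesFormula (V k φ : M) : Prop :=
  ∀ s t d e, IsAssignment V s → IsAssignment V t →
    (∀ i, IsNat i → i ≠ num 0 → i ≠ num 1 → i ≠ num 2 → i ≠ num 3 → App s i d ∧ App t i e) →
    (∀ i, IsNat i → ∃ x y, App s i x ∧ App k x y ∧ App t i y) →
    (Satisfies V φ s ↔ Satisfies V φ t)

/-- `k` is a function from `V` to `V` that preserves all formulas under assignments that are
constant outside of the first four variables. -/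
def IsPreserving (V k : M) : Prop :=
  IsFunction k V V ∧ ∀ φ, IsFormula φ → PreservesFormula V k φ

instance dfn_preservesFormula {n : ℕ} {g₁ g₂ g₃ : (Fin n → M) → M} [DfnFun (ambient M) g₁]
    [DfnFun (ambient M) g₂] [DfnFun (ambient M) g₃] :
    Dfn (ambient M) fun v => PreservesFormula (g₁ v) (g₂ v) (g₃ v) :=
  Dfn.comp₃ PreservesFormula (by unfold PreservesFormula; infer_instance)

instance dfn_isPreserving {n : ℕ} {g₁ g₂ : (Fin n → M) → M} [DfnFun (ambient M) g₁]
    [DfnFun (ambient M) g₂] : Dfn (ambient M) fun v => IsPreserving (g₁ v) (g₂ v) :=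
  Dfn.comp₂ IsPreserving (by unfold IsPreserving; infer_instance)

theorem IsElementary.isPreserving {V k : M} (h : IsElementary V k) : IsPreserving V k := by
  refine ⟨h.1, fun φ hφ s t _ _ hs ht _ hst => h.2 φ hφ s t hs ht fun i x y hx hxy => ?_⟩
  have hi : IsNat i := by
    obtain ⟨w, hw, hsf⟩ := hs
    exact (hw i).1 (hsf.mem hx).1
  obtain ⟨x', y', hx', hxy', hy'⟩ := hst i hi
  obtain rfl := hs.unique hx hx'
  exact h.1.unique hxy hxy' ▸ hy'

/-! ### Tuples of length two and four -/

theorem isTuple_two_iff {x y d s : M} : IsTuple ![x, y] d s ↔ App s (num 0) x ∧ App s (num 1) y ∧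
    ∀ k, IsNat k → k ≠ num 0 → k ≠ num 1 → App s k d := by
  simp [IsTuple, Fin.forall_fin_succ, and_assoc]

theorem isTuple_four_iff {x₀ x₁ x₂ x₃ d s : M} : IsTuple ![x₀, x₁, x₂, x₃] d s ↔
    App s (num 0) x₀ ∧ App s (num 1) x₁ ∧ App s (num 2) x₂ ∧ App s (num 3) x₃ ∧
    ∀ k, IsNat k → k ≠ num 0 → k ≠ num 1 → k ≠ num 2 → k ≠ num 3 → App s k d := by
  simp [IsTuple, Fin.forall_fin_succ, and_assoc]

/-- A relation preserves a formula if and only if it does so for tuples. -/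
theorem preservesFormula_iff {V k φ : M} (hk : ∀ x y, App k x y → x ∈ V ∧ y ∈ V) :
    PreservesFormula V k φ ↔ ∀ x₀ x₁ x₂ x₃ x₄ y₀ y₁ y₂ y₃ y₄ : Carrier V,
      App k x₀.1 y₀.1 → App k x₁.1 y₁.1 → App k x₂.1 y₂.1 → App k x₃.1 y₃.1 → App k x₄.1 y₄.1 →
      (Sat V φ ![x₀, x₁, x₂, x₃] x₄ ↔ Sat V φ ![y₀, y₁, y₂, y₃] y₄) := by
  have hval : ∀ x₀ x₁ x₂ x₃ : Carrier V,
      (fun i => (![x₀, x₁, x₂, x₃] i).1) = ![x₀.1, x₁.1, x₂.1, x₃.1] := fun x₀ x₁ x₂ x₃ => by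
    funext i
    fin_cases i <;> rfl
  constructor
  · intro h x₀ x₁ x₂ x₃ x₄ y₀ y₁ y₂ y₃ y₄ h₀ h₁ h₂ h₃ h₄
    have key : ∀ z₀ z₁ z₂ z₃ z₄ : Carrier V, ∃ s, IsAssignment V s ∧
        IsTuple (fun i => (![z₀, z₁, z₂, z₃] i).1) z₄.1 s := fun z₀ z₁ z₂ z₃ z₄ =>
      exists_isTuple (fun i => (![z₀, z₁, z₂, z₃] i).2) z₄.2
    obtain ⟨s, hs, hs'⟩ := key x₀ x₁ x₂ x₃ x₄
    obtain ⟨t, ht, ht'⟩ := key y₀ y₁ y₂ y₃ y₄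
    rw [sat_iff hs hs', sat_iff ht ht']
    rw [hval, isTuple_four_iff] at hs' ht'
    obtain ⟨a₀, a₁, a₂, a₃, a₄⟩ := hs'
    obtain ⟨b₀, b₁, b₂, b₃, b₄⟩ := ht'
    refine h s t _ _ hs ht (fun i hi n₀ n₁ n₂ n₃ =>
      ⟨a₄ i hi n₀ n₁ n₂ n₃, b₄ i hi n₀ n₁ n₂ n₃⟩) fun i hi => ?_
    by_cases n₀ : i = num 0
    · exact ⟨_, _, n₀ ▸ a₀, h₀, n₀ ▸ b₀⟩
    by_cases n₁ : i = num 1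
    · exact ⟨_, _, n₁ ▸ a₁, h₁, n₁ ▸ b₁⟩
    by_cases n₂ : i = num 2
    · exact ⟨_, _, n₂ ▸ a₂, h₂, n₂ ▸ b₂⟩
    by_cases n₃ : i = num 3
    · exact ⟨_, _, n₃ ▸ a₃, h₃, n₃ ▸ b₃⟩
    exact ⟨_, _, a₄ i hi n₀ n₁ n₂ n₃, h₄, b₄ i hi n₀ n₁ n₂ n₃⟩
  · intro h s t d e hs ht hde hst
    have key : ∀ n : ℕ, ∃ x y : Carrier V, App s (num n) x.1 ∧ App k x.1 y.1 ∧
        App t (num n) y.1 := fun n => by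
      obtain ⟨x, y, hx, hxy, hy⟩ := hst _ (isNat_num n)
      exact ⟨⟨x, (hk x y hxy).1⟩, ⟨y, (hk x y hxy).2⟩, hx, hxy, hy⟩
    obtain ⟨x₀, y₀, a₀, h₀, b₀⟩ := key 0
    obtain ⟨x₁, y₁, a₁, h₁, b₁⟩ := key 1
    obtain ⟨x₂, y₂, a₂, h₂, b₂⟩ := key 2
    obtain ⟨x₃, y₃, a₃, h₃, b₃⟩ := key 3
    obtain ⟨x₄, y₄, a₄, h₄, b₄⟩ := key 4
    -- The constant values `d` and `e` are not assumed to be related by `k`. They are read off at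
    -- `v_4`, the first variable outside the listed four.
    have hd := hde (num 4) (isNat_num 4) (by simp [num_inj]) (by simp [num_inj])
      (by simp [num_inj]) (by simp [num_inj])
    rw [hs.unique hd.1 a₄, ht.unique hd.2 b₄] at hde
    rw [← sat_iff hs (v := ![x₀, x₁, x₂, x₃]) (d := x₄), ← sat_iff ht (v := ![y₀, y₁, y₂, y₃])
      (d := y₄)]
    · exact h _ _ _ _ _ _ _ _ _ _ h₀ h₁ h₂ h₃ h₄
    · rw [hval, isTuple_four_iff]
      exact ⟨b₀, b₁, b₂, b₃, fun i hi n₀ n₁ n₂ n₃ => (hde i hi n₀ n₁ n₂ n₃).2⟩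
    · rw [hval, isTuple_four_iff]
      exact ⟨a₀, a₁, a₂, a₃, fun i hi n₀ n₁ n₂ n₃ => (hde i hi n₀ n₁ n₂ n₃).1⟩

namespace IsPreserving

variable {V k : M} (hk : IsPreserving V k)
include hk

theorem exists_app (x : Carrier V) : ∃ y : Carrier V, App k x.1 y.1 := by
  obtain ⟨y, hy⟩ := hk.1.exists x.2
  exact ⟨⟨y, (hk.1.mem hy).2⟩, hy⟩

theorem preserves [HasTruth V]
    (R : Carrier V → Carrier V → Carrier V → Carrier V → Carrier V → Prop)
    [hR : Dfn (inner V) fun v : Fin 5 → Carrier V => R (v 0) (v 1) (v 2) (v 3) (v 4)]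
    {x₀ x₁ x₂ x₃ x₄ y₀ y₁ y₂ y₃ y₄ : Carrier V} (h₀ : App k x₀.1 y₀.1) (h₁ : App k x₁.1 y₁.1)
    (h₂ : App k x₂.1 y₂.1) (h₃ : App k x₃.1 y₃.1) (h₄ : App k x₄.1 y₄.1) :
    R x₀ x₁ x₂ x₃ x₄ ↔ R y₀ y₁ y₂ y₃ y₄ := by
  obtain ⟨φ, hφ, hsat⟩ := hR.out
  have key : ∀ z₀ z₁ z₂ z₃ z₄ : Carrier V,
      Sat V φ ![z₀, z₁, z₂, z₃] z₄ ↔ R z₀ z₁ z₂ z₃ z₄ := fun z₀ z₁ z₂ z₃ z₄ => by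
    obtain ⟨s, hs, hst⟩ := exists_isTuple (fun i => (![z₀, z₁, z₂, z₃] i).2) z₄.2
    rw [sat_iff hs hst]
    refine hsat s hs ![z₀, z₁, z₂, z₃, z₄] fun i => ?_
    fin_cases i
    · exact hst.1 0
    · exact hst.1 1
    · exact hst.1 2
    · exact hst.1 3
    -- The fifth argument is the default value, which is also the value of `v_4`.
    · refine hst.2 _ (isNat_num 4) fun i hi => ?_
      have := num_inj (i := 4).1 hi
      have := i.2
      omega
  rw [← key, ← key]
  exact (preservesFormula_iff fun x y h => hk.1.mem h).1 (hk.2 φ hφ) _ _ _ _ _ _ _ _ _ _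
    h₀ h₁ h₂ h₃ h₄

theorem mem_iff [HasTruth V] {x y x' y' : Carrier V} (hx : App k x.1 x'.1) (hy : App k y.1 y'.1) :
    x.1 ∈ y.1 ↔ x'.1 ∈ y'.1 :=
  hk.preserves (fun x y _ _ _ => x ∈ y) hx hy hy hy hy

end IsPreserving

/-! ### Hereditarily finite sets -/

/-- `z = x ∪ {y}`. -/
def IsAdjoin (z x y : M) : Prop := ∀ u, u ∈ z ↔ u ∈ x ∨ u = y

/-- `F` contains `∅` and is closed under `x, y ↦ x ∪ {y}`. -/
def AdjoinClosed (F : M) : Prop :=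
  empty ∈ F ∧ ∀ x y z, x ∈ F → y ∈ F → IsAdjoin z x y → z ∈ F

/-- `H` is the set of hereditarily finite sets. -/
def IsHF (H : M) : Prop := AdjoinClosed H ∧ ∀ F : M, AdjoinClosed F → ∀ x, x ∈ H → x ∈ F

section

variable {n : ℕ} {g₁ g₂ g₃ : (Fin n → M) → M} [DfnFun (ambient M) g₁]
  [DfnFun (ambient M) g₂] [DfnFun (ambient M) g₃]

instance dfn_isAdjoin : Dfn (ambient M) fun v => IsAdjoin (g₁ v) (g₂ v) (g₃ v) :=
  Dfn.comp₃ IsAdjoin (by unfold IsAdjoin; infer_instance)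

instance dfn_adjoinClosed : Dfn (ambient M) fun v => AdjoinClosed (g₁ v) :=
  Dfn.comp₁ AdjoinClosed (by unfold AdjoinClosed; infer_instance)

end

theorem IsAdjoin.unique {z z' x y : M} (h : IsAdjoin z x y) (h' : IsAdjoin z' x y) : z = z' :=
  ext fun u => (h u).trans (h' u).symm

theorem isAdjoin_succ (x : M) : IsAdjoin (succ x) x x := mem_succ x

theorem AdjoinClosed.exists_isHF {W : M} (hW : AdjoinClosed W) :
    ∃ H : M, IsHF H ∧ ∀ x, x ∈ H → x ∈ W := by
  obtain ⟨H, hH⟩ := exists_sep (fun x => ∀ F : M, AdjoinClosed F → x ∈ F) W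
  refine ⟨H, ⟨⟨(hH _).2 ⟨hW.1, fun F hF => hF.1⟩, fun x y z hx hy hz => ?_⟩,
    fun F hF x hx => ((hH x).1 hx).2 F hF⟩, fun x hx => ((hH x).1 hx).1⟩
  rw [hH] at hx hy ⊢
  exact ⟨hW.2 x y z hx.1 hy.1 hz, fun F hF => hF.2 x y z (hx.2 F hF) (hy.2 F hF) hz⟩

namespace IsHF

variable {H : M} (hH : IsHF H) {x y : M}
include hH

theorem induction (P : M → Prop) [Dfn (ambient M) fun v : Fin 1 → M => P (v 0)] (h0 : P empty)
    (hadj : ∀ x y z, x ∈ H → y ∈ H → z ∈ H → P x → P y → IsAdjoin z x y → P z) :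
    ∀ x, x ∈ H → P x := by
  obtain ⟨F, hF⟩ := exists_sep P H
  refine fun x hx => ((hF x).1 (hH.2 F ⟨(hF _).2 ⟨hH.1.1, h0⟩, fun x y z hx hy hz => ?_⟩ x hx)).2
  rw [hF] at hx hy ⊢
  have := hH.1.2 x y z hx.1 hy.1 hz
  exact ⟨this, hadj x y z hx.1 hy.1 this hx.2 hy.2 hz⟩

theorem upair_mem (hx : x ∈ H) (hy : y ∈ H) : upair x y ∈ H := by
  refine hH.1.2 (upair x x) y _ (hH.1.2 empty x _ hH.1.1 hx fun u => ?_) hy fun u => ?_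
  · simp [mem_upair, not_mem_empty]
  · simp [mem_upair]

theorem opair_mem (hx : x ∈ H) (hy : y ∈ H) : opair x y ∈ H :=
  hH.upair_mem (hH.upair_mem hx hx) (hH.upair_mem hx hy)

theorem isNat_mem (hx : IsNat x) : x ∈ H :=
  hx H hH.1.1 fun x hx => hH.1.2 x x _ hx hx (isAdjoin_succ x)

theorem isFormula_mem (hx : IsFormula x) : x ∈ H := by
  have hn : ∀ n, (num n : M) ∈ H := fun n => hH.isNat_mem (isNat_num n)
  exact hx H ⟨fun i k hi hk => ⟨hH.opair_mem (hn _) (hH.opair_mem (hH.isNat_mem hi)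
    (hH.isNat_mem hk)), hH.opair_mem (hn _) (hH.opair_mem (hH.isNat_mem hi) (hH.isNat_mem hk))⟩,
    fun φ h => hH.opair_mem (hn _) h, fun φ ψ h h' => hH.opair_mem (hn _) (hH.opair_mem h h'),
    fun i φ hi h => hH.opair_mem (hn _) (hH.opair_mem (hH.isNat_mem hi) h)⟩

end IsHF

/-! ### Quine-Rosser pairs described by bounded quantifiers -/

theorem eq_empty_iff {x : M} : x = empty ↔ ∀ u, u ∉ x :=
  ⟨fun h => h ▸ not_mem_empty, fun h => ext fun u => iff_of_false (h u) (not_mem_empty u)⟩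

theorem isTagZero_iff {w u : M} : IsTagZero w u ↔
    (∀ t, t ∈ w → ∃ e, e ∈ u ∧ t = shift e) ∧ ∀ e, e ∈ u → ∃ t, t ∈ w ∧ t = shift e := by
  unfold IsTagZero
  grind

theorem isTagOne_iff {w u : M} : IsTagOne w u ↔
    (∀ t, t ∈ w → t = empty ∨ ∃ e, e ∈ u ∧ t = shift e) ∧
      (∀ e, e ∈ u → ∃ t, t ∈ w ∧ t = shift e) ∧ ∃ t, t ∈ w ∧ t = empty := by
  unfold IsTagOne
  grind

theorem exists_shift_image (u : M) : ∃ w : M, ∀ t, t ∈ w ↔ ∃ e, e ∈ u ∧ t = shift e := by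
  obtain ⟨o, ho⟩ := exists_omega (M := M)
  obtain ⟨U, hU⟩ := exists_union o u
  obtain ⟨w, hw⟩ := exists_sep (fun t => ∃ e, e ∈ u ∧ t = shift e) U
  refine ⟨w, fun t => (hw t).trans ⟨And.right, fun h => ⟨(hU t).2 ?_, h⟩⟩⟩
  obtain ⟨e, he, ht⟩ := h
  rcases eq_shift_iff.1 ht with ⟨h, rfl⟩ | ⟨_, rfl⟩
  exacts [Or.inl ((ho _).2 h.succ), Or.inr he]

theorem exists_isTagOne (u : M) : ∃ w : M, IsTagOne w u := by
  obtain ⟨w, hw⟩ := exists_shift_image u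
  obtain ⟨w', hw'⟩ := exists_union (upair empty empty) w
  exact ⟨w', fun t => by simp [hw', mem_upair, hw]⟩

/-- All quantifiers over tagged sets become bounded by `z`, so that the notion can be evaluated in a
transitive `V`. The equivalence uses that `f₀(u)` and `f₁(u)` exist and are unique. -/
theorem isQRPair_iff {z x y : M} : IsQRPair z x y ↔
    (∀ w, w ∈ z → (∃ u, u ∈ x ∧ IsTagZero w u) ∨ ∃ u, u ∈ y ∧ IsTagOne w u) ∧
      (∀ u, u ∈ x → ∃ w, w ∈ z ∧ IsTagZero w u) ∧ ∀ u, u ∈ y → ∃ w, w ∈ z ∧ IsTagOne w u := by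
  constructor
  · intro h
    refine ⟨fun w => (h w).1, fun u hu => ?_, fun u hu => ?_⟩
    · obtain ⟨w, hw⟩ := exists_shift_image u
      exact ⟨w, (h w).2 (Or.inl ⟨u, hu, hw⟩), hw⟩
    · obtain ⟨w, hw⟩ := exists_isTagOne u
      exact ⟨w, (h w).2 (Or.inr ⟨u, hu, hw⟩), hw⟩
  · rintro ⟨h, h0, h1⟩ w
    refine ⟨h w, ?_⟩
    rintro (⟨u, hu, hw⟩ | ⟨u, hu, hw⟩)
    · obtain ⟨w', hwz, hw'⟩ := h0 u hu
      rwa [ext fun t => (hw t).trans (hw' t).symm]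
    · obtain ⟨w', hwz, hw'⟩ := h1 u hu
      rwa [ext fun t => (hw t).trans (hw' t).symm]

/-! ### Sufficiently closed transitive sets -/

/-- `V` is transitive, closed under subsets, and contains the set of hereditarily finite sets. -/
class IsSuitable (V : M) : Prop where
  trans : ∀ {x y : M}, x ∈ V → y ∈ x → y ∈ V
  swelled : ∀ {x y : M}, x ∈ V → (∀ z, z ∈ y → z ∈ x) → y ∈ V
  exists_hf : ∃ H, H ∈ V ∧ IsHF H

section Suitable

variable (V : M) [hV : IsSuitable V]

/-- The set of hereditarily finite sets. -/
noncomputable def hf : M := Classical.choose hV.exists_hf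

theorem hf_mem : hf V ∈ V := (Classical.choose_spec hV.exists_hf).1

theorem isHF_hf : IsHF (hf V) := (Classical.choose_spec hV.exists_hf).2

variable {V}

theorem mem_of_mem_hf {x : M} (hx : x ∈ hf V) : x ∈ V := hV.trans (hf_mem V) hx

theorem empty_mem : (empty : M) ∈ V := mem_of_mem_hf (isHF_hf V).1.1

/-- Closure under the operations that generate the hereditarily finite sets, as seen in `V`. -/
def RelAdjoinClosed (V F : M) : Prop :=
  (∀ e, e ∈ V → e = empty → e ∈ F) ∧
    ∀ x, x ∈ F → ∀ y, y ∈ F → ∀ z, z ∈ V → IsAdjoin z x y → z ∈ F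

theorem relAdjoinClosed_hf : RelAdjoinClosed V (hf V) :=
  ⟨fun _ _ he => he ▸ (isHF_hf V).1.1, fun x hx y hy z _ hz => (isHF_hf V).1.2 x y z hx hy hz⟩

theorem RelAdjoinClosed.hf_subset {F : M} (hF : RelAdjoinClosed V F) : ∀ x, x ∈ hf V → x ∈ F :=
  (isHF_hf V).induction (fun x => x ∈ F) (hF.1 _ empty_mem rfl)
    fun x y z _ _ hz hx hy h => hF.2 x hx y hy z (mem_of_mem_hf hz) h

/-- `c` is the section `(a)_x`, as seen in `V`. -/
def RelSection (V c a x : M) : Prop := ∀ y, y ∈ V → (y ∈ c ↔ ∃ z, z ∈ a ∧ IsQRPair z x y)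

theorem RelSection.unique {c c' a x : M} (hc : c ∈ V) (hc' : c' ∈ V) (h : RelSection V c a x)
    (h' : RelSection V c' a x) : c = c' :=
  ext fun y => ⟨fun hy => (h' y (hV.trans hc hy)).2 ((h y (hV.trans hc hy)).1 hy),
    fun hy => (h y (hV.trans hc' hy)).2 ((h' y (hV.trans hc' hy)).1 hy)⟩

/-! ### Pairs that do not increase the rank -/

/-- `w` codes the pair of the hereditarily finite set `ψ` and the set `y`: it consists of
`{e}` for hereditarily finite `e ∈ y`, of all other `e ∈ y`, and of the marker `{∅, {ψ}}`. -/
def IsFlatPair (V : M) [IsSuitable V] (w ψ y : M) : Prop :=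
  ∀ t, t ∈ V → (t ∈ w ↔ (∃ e, e ∈ y ∧ ((e ∈ hf V ∧ t = upair e e) ∨ (e ∉ hf V ∧ t = e))) ∨
    t = upair empty (upair ψ ψ))

instance ambient_isFlatPair {m : ℕ} {k₁ k₂ k₃ : (Fin m → M) → M} [DfnFun (ambient M) k₁]
    [DfnFun (ambient M) k₂] [DfnFun (ambient M) k₃] :
    Dfn (ambient M) fun v => IsFlatPair V (k₁ v) (k₂ v) (k₃ v) :=
  Dfn.comp₃ (IsFlatPair V) (by unfold IsFlatPair; infer_instance)

theorem marker_mem_hf {ψ : M} (hψ : ψ ∈ hf V) : upair empty (upair ψ ψ) ∈ hf V :=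
  (isHF_hf V).upair_mem (isHF_hf V).1.1 ((isHF_hf V).upair_mem hψ hψ)

/-- Otherwise `∅` and `{ψ}` would both equal `e`. Hence the marker of a flat pair cannot be confused
with a replaced element `{e}`. -/
theorem marker_ne_singleton {ψ e : M} : upair empty (upair ψ ψ) ≠ upair e e := by
  intro h
  have h1 : empty ∈ upair e e := h ▸ (mem_upair _ _ _).2 (Or.inl rfl)
  have h2 : upair ψ ψ ∈ upair e e := h ▸ (mem_upair _ _ _).2 (Or.inr rfl)
  simp only [mem_upair, or_self] at h1 h2
  exact not_mem_empty ψ (h1.trans h2.symm ▸ (mem_upair ψ ψ ψ).2 (Or.inl rfl))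

theorem IsFlatPair.unique {w w' ψ y : M} (hw : w ∈ V) (hw' : w' ∈ V) (h : IsFlatPair V w ψ y)
    (h' : IsFlatPair V w' ψ y) : w = w' :=
  ext fun t => ⟨fun ht => (h' t (hV.trans hw ht)).2 ((h t (hV.trans hw ht)).1 ht),
    fun ht => (h t (hV.trans hw' ht)).2 ((h' t (hV.trans hw' ht)).1 ht)⟩

/-- The marker is hereditarily finite, so it is not one of the unchanged elements; it is not a
singleton, so it is not one of the replaced ones. -/
theorem IsFlatPair.left_inj {w ψ ψ' y y' : M} (hψ : ψ ∈ hf V) (h : IsFlatPair V w ψ y)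
    (h' : IsFlatPair V w ψ' y') : ψ = ψ' := by
  have hm := mem_of_mem_hf (marker_mem_hf hψ)
  rcases (h' _ hm).1 ((h _ hm).2 (Or.inr rfl)) with ⟨e, he, ⟨_, h1⟩ | ⟨h1, h2⟩⟩ | h1
  · exact absurd h1 marker_ne_singleton
  · exact absurd (h2 ▸ marker_mem_hf hψ) h1
  · exact upair_self_inj (upair_eq_left h1)

theorem IsFlatPair.subset {w ψ y y' : M} (hy : y ∈ V) (hψ : ψ ∈ hf V)
    (h : IsFlatPair V w ψ y) (h' : IsFlatPair V w ψ y') {e : M} (he : e ∈ y) : e ∈ y' := by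
  by_cases heH : e ∈ hf V
  · have ht := mem_of_mem_hf ((isHF_hf V).upair_mem heH heH)
    rcases (h' _ ht).1 ((h _ ht).2 (Or.inl ⟨e, he, Or.inl ⟨heH, rfl⟩⟩)) with
      ⟨e', he', ⟨_, h1⟩ | ⟨h1, h2⟩⟩ | h1
    · exact upair_self_inj h1 ▸ he'
    · exact absurd (h2 ▸ (isHF_hf V).upair_mem heH heH) h1
    · exact absurd h1.symm marker_ne_singleton
  · have ht := hV.trans hy he
    rcases (h' _ ht).1 ((h _ ht).2 (Or.inl ⟨e, he, Or.inr ⟨heH, rfl⟩⟩)) with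
      ⟨e', he', ⟨h0, h1⟩ | ⟨h1, h2⟩⟩ | h1
    · exact absurd (h1 ▸ (isHF_hf V).upair_mem h0 h0) heH
    · exact h2 ▸ he'
    · exact absurd (h1 ▸ marker_mem_hf hψ) heH

theorem IsFlatPair.inj {w ψ ψ' y y' : M} (hψ : ψ ∈ hf V) (hy : y ∈ V) (hy' : y' ∈ V)
    (h : IsFlatPair V w ψ y) (h' : IsFlatPair V w ψ' y') : ψ = ψ' ∧ y = y' := by
  obtain rfl := h.left_inj hψ h'
  exact ⟨rfl, ext fun e => ⟨h.subset hy hψ h', h'.subset hy' hψ h⟩⟩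

/-! ### Definability over sufficiently closed transitive sets -/

variable [HasTruth V] {n : ℕ} {g₁ g₂ g₃ : (Fin n → Carrier V) → Carrier V}

instance inner_forall_mem {P : (Fin n → Carrier V) → M → Prop}
    [h : Dfn (inner V) fun w : Fin (n + 1) → Carrier V => P (fun i => w i.succ) (w 0).1] :
    Dfn (inner V) fun v => ∀ x : M, x ∈ V → P v x :=
  (inferInstance : Dfn (inner V) fun v => ∀ x : Carrier V, P v x.1).congr fun _ =>
    ⟨fun h x => h x.1 x.2, fun h x hx => h ⟨x, hx⟩⟩

instance inner_exists_mem {P : (Fin n → Carrier V) → M → Prop}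
    [h : Dfn (inner V) fun w : Fin (n + 1) → Carrier V => P (fun i => w i.succ) (w 0).1] :
    Dfn (inner V) fun v => ∃ x : M, x ∈ V ∧ P v x :=
  (inferInstance : Dfn (inner V) fun v => ∃ x : Carrier V, P v x.1).congr fun _ =>
    ⟨fun ⟨x, hx, h⟩ => ⟨⟨x, hx⟩, h⟩, fun ⟨x, h⟩ => ⟨x.1, x.2, h⟩⟩

variable [h₁ : DfnFun (inner V) g₁] [h₂ : DfnFun (inner V) g₂] [h₃ : DfnFun (inner V) g₃]

instance inner_mem : Dfn (inner V) fun v => (g₁ v).1 ∈ (g₂ v).1 :=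
  (inferInstance : Dfn (inner V) fun v => g₁ v ∈ g₂ v)

instance inner_eq : Dfn (inner V) fun v => (g₁ v).1 = (g₂ v).1 :=
  (inferInstance : Dfn (inner V) fun v => g₁ v = g₂ v).congr fun _ => Subtype.ext_iff.symm

instance inner_ball {P : (Fin n → Carrier V) → M → Prop}
    [h : Dfn (inner V) fun w : Fin (n + 1) → Carrier V => P (fun i => w i.succ) (w 0).1] :
    Dfn (inner V) fun v => ∀ x : M, x ∈ (g₁ v).1 → P v x := by
  have := h₁.weaken
  exact (inferInstance : Dfn (inner V) fun v => ∀ x : Carrier V, x.1 ∈ (g₁ v).1 → P v x.1).congr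
    fun v => ⟨fun h x hx => h x.1 hx, fun h x hx => h ⟨x, hV.trans (g₁ v).2 hx⟩ hx⟩

instance inner_bex {P : (Fin n → Carrier V) → M → Prop}
    [h : Dfn (inner V) fun w : Fin (n + 1) → Carrier V => P (fun i => w i.succ) (w 0).1] :
    Dfn (inner V) fun v => ∃ x : M, x ∈ (g₁ v).1 ∧ P v x := by
  have := h₁.weaken
  exact (inferInstance : Dfn (inner V) fun v => ∃ x : Carrier V, x.1 ∈ (g₁ v).1 ∧ P v x.1).congr
    fun v => ⟨fun ⟨x, hx, h⟩ => ⟨⟨x, hV.trans (g₁ v).2 hx⟩, hx, h⟩, fun ⟨x, hx, h⟩ => ⟨x.1, hx, h⟩⟩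

instance inner_upair : Dfn (inner V) fun v => (g₁ v).1 = upair (g₂ v).1 (g₃ v).1 :=
  Dfn.comp₃ (fun a b c : Carrier V => a.1 = upair b.1 c.1)
    ((inferInstance : Dfn (inner V) fun v : Fin 3 → Carrier V =>
      (∀ u, u ∈ (v 0).1 → u = (v 1).1 ∨ u = (v 2).1) ∧ (v 1).1 ∈ (v 0).1 ∧
        (v 2).1 ∈ (v 0).1).congr fun v => by
      rw [eq_upair_iff]
      constructor
      · intro h
        exact ⟨fun u => (h u).1, (h _).2 (Or.inl rfl), (h _).2 (Or.inr rfl)⟩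
      · rintro ⟨h, h', h''⟩ u
        exact ⟨h u, fun hu => by rcases hu with rfl | rfl <;> assumption⟩)

instance inner_isAdjoin : Dfn (inner V) fun v => IsAdjoin (g₁ v).1 (g₂ v).1 (g₃ v).1 :=
  Dfn.comp₃ (fun a b c : Carrier V => IsAdjoin a.1 b.1 c.1)
    ((inferInstance : Dfn (inner V) fun v : Fin 3 → Carrier V =>
      (∀ u, u ∈ (v 0).1 → u ∈ (v 1).1 ∨ u = (v 2).1) ∧ (∀ u, u ∈ (v 1).1 → u ∈ (v 0).1) ∧
        (v 2).1 ∈ (v 0).1).congr fun v => by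
      constructor
      · intro h
        exact ⟨fun u => (h u).1, fun u hu => (h u).2 (Or.inl hu), (h _).2 (Or.inr rfl)⟩
      · rintro ⟨h, h', h''⟩ u
        exact ⟨h u, fun hu => hu.elim (h' u) fun hu => hu ▸ h''⟩)

instance inner_empty : Dfn (inner V) fun v => (g₁ v).1 = empty :=
  Dfn.comp₁ (fun a : Carrier V => a.1 = empty)
    ((inferInstance : Dfn (inner V) fun v : Fin 1 → Carrier V =>
      ∀ u, u ∈ (v 0).1 → ¬ u = u).congr fun _ => by simp [eq_empty_iff])

instance inner_relAdjoinClosed : Dfn (inner V) fun v => RelAdjoinClosed V (g₁ v).1 :=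
  Dfn.comp₁ (fun a : Carrier V => RelAdjoinClosed V a.1) (by
    unfold RelAdjoinClosed; infer_instance)

/-- Minimality may be tested against closed sets in `V` alone, because `hf V` is itself one of them.
-/
instance inner_eq_hf : Dfn (inner V) fun v => (g₁ v).1 = hf V :=
  Dfn.comp₁ (fun a : Carrier V => a.1 = hf V)
    ((inferInstance : Dfn (inner V) fun v : Fin 1 → Carrier V =>
      RelAdjoinClosed V (v 0).1 ∧ ∀ F, F ∈ V → RelAdjoinClosed V F →
        ∀ x, x ∈ (v 0).1 → x ∈ F).congr fun v => by
      constructor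
      · intro h
        rw [h]
        exact ⟨relAdjoinClosed_hf, fun F _ hF => hF.hf_subset⟩
      · rintro ⟨h, h'⟩
        exact ext fun x => ⟨h' _ (hf_mem V) relAdjoinClosed_hf x, h.hf_subset x⟩)

instance inner_mem_hf : Dfn (inner V) fun v => (g₁ v).1 ∈ hf V :=
  Dfn.comp₁ (fun a : Carrier V => a.1 ∈ hf V)
    ((inferInstance : Dfn (inner V) fun v : Fin 1 → Carrier V =>
      ∃ H, H ∈ V ∧ H = hf V ∧ (v 0).1 ∈ H).congr fun _ =>
      ⟨fun h => ⟨_, hf_mem V, rfl, h⟩, fun ⟨_, _, h, h'⟩ => h ▸ h'⟩)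

instance inner_isNat : Dfn (inner V) fun v => IsNat (g₁ v).1 :=
  Dfn.comp₁ (fun a : Carrier V => IsNat a.1)
    ((inferInstance : Dfn (inner V) fun v : Fin 1 → Carrier V =>
      ∀ w, w ∈ V → (∀ e, e ∈ V → e = empty → e ∈ w) →
        (∀ x, x ∈ w → ∀ y, y ∈ V → IsAdjoin y x x → y ∈ w) → (v 0).1 ∈ w).congr fun v => by
      obtain ⟨o, ho⟩ := exists_omega (M := M)
      -- Since `ω` is a subset of `hf V`, it belongs to `V`, so quantifying over inductive sets in
      -- `V` is enough.
      have hoV : o ∈ V := hV.swelled (hf_mem V) fun z hz => (isHF_hf V).isNat_mem ((ho z).1 hz)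
      constructor
      · intro h w _ h0 hs
        -- The closure of `w` concerns only successors that lie in `V`. Intersecting with `ω` gives
        -- a set that is inductive outright.
        obtain ⟨u, hu⟩ := exists_sep (fun x => x ∈ w) o
        refine ((hu _).1 (h u ((hu _).2 ⟨(ho _).2 isNat_empty, h0 _ empty_mem rfl⟩) ?_)).2
        intro x hx
        rw [hu, ho] at hx ⊢
        exact ⟨hx.1.succ, hs x hx.2 _ (mem_of_mem_hf ((isHF_hf V).isNat_mem hx.1.succ))
          (isAdjoin_succ x)⟩
      · intro h
        refine (ho _).1 (h o hoV (fun e _ he => he ▸ (ho _).2 isNat_empty) fun x hx y _ hy => ?_)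
        rw [hy.unique (isAdjoin_succ x), ho]
        exact ((ho x).1 hx).succ)

instance inner_succ : Dfn (inner V) fun v => (g₁ v).1 = succ (g₂ v).1 :=
  (inferInstance : Dfn (inner V) fun v => IsAdjoin (g₁ v).1 (g₂ v).1 (g₂ v).1).congr fun _ =>
    eq_succ_iff

instance inner_shift : Dfn (inner V) fun v => (g₁ v).1 = shift (g₂ v).1 := by
  simp only [eq_shift_iff]
  infer_instance

instance inner_isTagZero : Dfn (inner V) fun v => IsTagZero (g₁ v).1 (g₂ v).1 :=
  Dfn.comp₂ (fun a b : Carrier V => IsTagZero a.1 b.1) (by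
    simp only [isTagZero_iff]; infer_instance)

instance inner_isTagOne : Dfn (inner V) fun v => IsTagOne (g₁ v).1 (g₂ v).1 :=
  Dfn.comp₂ (fun a b : Carrier V => IsTagOne a.1 b.1) (by
    simp only [isTagOne_iff]; infer_instance)

instance inner_isQRPair : Dfn (inner V) fun v => IsQRPair (g₁ v).1 (g₂ v).1 (g₃ v).1 :=
  Dfn.comp₃ (fun a b c : Carrier V => IsQRPair a.1 b.1 c.1) (by
    simp only [isQRPair_iff]; infer_instance)

instance inner_relSection : Dfn (inner V) fun v => RelSection V (g₁ v).1 (g₂ v).1 (g₃ v).1 :=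
  Dfn.comp₃ (fun a b c : Carrier V => RelSection V a.1 b.1 c.1) (by
    unfold RelSection; infer_instance)

instance inner_marker : Dfn (inner V) fun v => (g₁ v).1 = upair empty (upair (g₂ v).1 (g₂ v).1) :=
  Dfn.comp₂ (fun a b : Carrier V => a.1 = upair empty (upair b.1 b.1))
    ((inferInstance : Dfn (inner V) fun v : Fin 2 → Carrier V =>
      ∃ a, a ∈ V ∧ ∃ b, b ∈ V ∧ a = empty ∧ b = upair (v 1).1 (v 1).1 ∧
        (v 0).1 = upair a b).congr fun v => by
      constructor
      · intro h
        refine ⟨_, empty_mem, _, hV.trans (v 0).2 ?_, rfl, rfl, h⟩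
        rw [h, mem_upair]
        exact Or.inr rfl
      · rintro ⟨a, _, b, _, rfl, rfl, h⟩
        exact h)

instance inner_isFlatPair : Dfn (inner V) fun v => IsFlatPair V (g₁ v).1 (g₂ v).1 (g₃ v).1 :=
  Dfn.comp₃ (fun a b c : Carrier V => IsFlatPair V a.1 b.1 c.1) (by
    unfold IsFlatPair; infer_instance)

end Suitable

/-! ### The first moved level -/

theorem IsHierarchy.mem_trans {α V f x y : M} (h : IsHierarchy α V f) (hx : x ∈ V) (hy : y ∈ x) :
    y ∈ V :=
  h.level_trans h.top hx hy

namespace IsPreserving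

variable {V k : M} (hk : IsPreserving V k) [HasTruth V]
  (htrans : ∀ {x y : M}, x ∈ V → y ∈ x → y ∈ V)
include hk htrans

/-- A fixed point `u` of `k` lies in `z` if and only if it lies in `k(z)`. -/
theorem eq_of_fixed {z z' : Carrier V} (hz : App k z.1 z'.1) (h : ∀ u, u ∈ z.1 → App k u u)
    (h' : ∀ u, u ∈ z'.1 → App k u u) : z = z' := by
  refine Subtype.ext (ext fun u => ⟨fun hu => ?_, fun hu => ?_⟩)
  · have hu' : App k (⟨u, htrans z.2 hu⟩ : Carrier V).1 (⟨u, htrans z.2 hu⟩ : Carrier V).1 := h u hu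
    exact (hk.mem_iff hu' hz).1 hu
  · have hu' : App k (⟨u, htrans z'.2 hu⟩ : Carrier V).1 (⟨u, htrans z'.2 hu⟩ : Carrier V).1 :=
      h' u hu
    exact (hk.mem_iff hu' hz).2 hu

/-- If `k` moves `z` but no element of `z`, then it moves an element of `k(z)`. -/
theorem exists_moved {z z' : Carrier V} (hz : App k z.1 z'.1) (hne : ¬ App k z.1 z.1)
    (h : ∀ u, u ∈ z.1 → App k u u) : ∃ u : Carrier V, u.1 ∈ z'.1 ∧ ¬ App k u.1 u.1 := by
  by_contra! hcon
  have := hk.eq_of_fixed htrans hz h fun u hu => hcon ⟨u, htrans z'.2 hu⟩ hu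
  exact hne (this ▸ hz)

end IsPreserving

/-- The index `β < α` is a nonzero limit, and `W = V_β`. -/
structure IsLimitLevel (α f β W : M) : Prop where
  lt : β ∈ α
  level : App f β W
  pos : ∃ δ, δ ∈ β
  limit : ∀ δ, δ ∈ β → ∃ ε, ε ∈ β ∧ δ ∈ ε

/-- Take `β` least such that some `z ⊆ V_β` is moved. Then `k` fixes `V_β` pointwise, so `k(z)` has
an element outside `V_β`. This is impossible for `β = 0`, where `k(z)` is empty, and for `β = δ +
1`, where the elements of `k(z)` are subsets of `k(V_δ) = V_δ`. -/
theorem IsHierarchy.exists_isLimitLevel {α V f k : M} (h : IsHierarchy α V f) [HasTruth V]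
    (hk : IsPreserving V k) (hne : ∃ x, x ∈ V ∧ ¬ App k x x) : ∃ β W, IsLimitLevel α f β W := by
  obtain ⟨x, hx, hxne⟩ := hne
  obtain ⟨γ, t, hγ, ht, hxt⟩ := (h.recursion α V h.top x).1 hx
  obtain ⟨β, hβ, ⟨W, z, hW, hzV, hzW, hz⟩, hmin⟩ := exists_minimal
    (fun β => ∃ W z, App f β W ∧ z ∈ V ∧ (∀ u, u ∈ z → u ∈ W) ∧ ¬ App k z z) hγ
    ⟨t, x, ht, hx, hxt, hxne⟩
  have hfix : ∀ y, y ∈ W → App k y y := fun y hy => by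
    obtain ⟨δ, s, hδ, hs, hys⟩ := (h.recursion β W hW y).1 hy
    by_contra hcon
    exact hmin δ hδ (h.index_lt h.top (h.index_lt hW hδ))
      ⟨s, y, hs, h.level_subset hβ hW h.top hy, hys, hcon⟩
  obtain ⟨z', hz'⟩ := hk.exists_app ⟨z, hzV⟩
  obtain ⟨u, huz', hu⟩ := hk.exists_moved h.mem_trans hz' hz fun u hu => hfix u (hzW u hu)
  refine ⟨β, W, hβ, hW, ?_, fun δ hδ => ?_⟩
  · by_contra! hcon
    have hempty : ∀ u : Carrier V, u.1 ∉ z := fun u hu => by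
      obtain ⟨δ, -, hδ, -⟩ := (h.recursion β W hW u.1).1 (hzW u.1 hu)
      exact hcon δ hδ
    exact (hk.preserves (fun z _ _ _ _ => ∀ u, ¬ u ∈ z) hz' hz' hz' hz' hz').1 hempty u huz'
  · by_contra! hcon
    obtain ⟨s, hs⟩ := h.exists_level (h.index_lt hW hδ)
    have hsW : s ∈ W := h.mem_level hδ hs hW fun _ hu => hu
    have hsV : s ∈ V := h.level_subset hβ hW h.top hsW
    have hss : App k (⟨s, hsV⟩ : Carrier V).1 (⟨s, hsV⟩ : Carrier V).1 := hfix s hsW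
    -- If no index below `β` exceeds `δ`, then every element of `z ⊆ V_β` is a subset of `s = V_δ`.
    -- This property passes to `k(z)` because `s` is fixed.
    have hsub : ∀ y : Carrier V, y.1 ∈ z → ∀ x : Carrier V, x.1 ∈ y.1 → x.1 ∈ s := by
      intro y hy x hx
      obtain ⟨ε, t, hε, ht, hyt⟩ := (h.recursion β W hW y.1).1 (hzW y.1 hy)
      rcases h.ordinal.2 _ _ (h.index_lt hW hδ) (h.index_lt hW hε) with hlt | rfl | hlt
      · exact absurd hlt (hcon ε hε)
      · exact h.level_unique ht hs ▸ hyt x.1 hx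
      · exact h.level_subset hlt ht hs (hyt x.1 hx)
    have := (hk.preserves (fun z s _ _ _ => ∀ y, y ∈ z → ∀ x, x ∈ y → x ∈ s)
      hz' hss hss hss hss).1 hsub u huz'
    exact hu (hfix u.1 (h.mem_level hδ hs hW fun v hv => this ⟨v, h.mem_trans u.2 hv⟩ hv))

/-! ### Flat pairs inside the levels from the limit level on -/

theorem exists_isFlatPair_of_subset {V : M} [IsSuitable V] {r ψ y : M} (hr : ∀ e, e ∈ y → e ∈ r)
    (hr' : ∀ e, e ∈ y → e ∈ hf V → upair e e ∈ r) (hm : upair empty (upair ψ ψ) ∈ r) :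
    ∃ w, IsFlatPair V w ψ y ∧ ∀ t, t ∈ w → t ∈ r := by
  obtain ⟨w, hw⟩ := exists_sep (fun t =>
    (∃ e, e ∈ y ∧ ((e ∈ hf V ∧ t = upair e e) ∨ (e ∉ hf V ∧ t = e))) ∨
      t = upair empty (upair ψ ψ)) r
  refine ⟨w, fun t _ => (hw t).trans (and_iff_right_of_imp ?_), fun t ht => ((hw t).1 ht).1⟩
  rintro (⟨e, he, ⟨h1, rfl⟩ | ⟨_, rfl⟩⟩ | rfl)
  exacts [hr' e he h1, hr _ he, hm]

namespace IsLimitLevel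

variable {α V f β W : M} (h : IsHierarchy α V f) (hW : IsLimitLevel α f β W)
include h hW

/-- Sets included in a level below a limit belong, together with any given element of the limit
level, to a common level below the limit. -/
theorem exists_level_gt {δ s m : M} (hδ : δ ∈ β) (hs : App f δ s) (hm : m ∈ W) :
    ∃ ε t, ε ∈ β ∧ App f ε t ∧ (∀ y, (∀ u, u ∈ y → u ∈ s) → y ∈ t) ∧ (∀ y, y ∈ s → y ∈ t) ∧
      ∀ u, u ∈ m → u ∈ t := by
  obtain ⟨ε, t, hε, ht, hst, hmt⟩ := h.exists_common_level hW.level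
    (h.mem_level hδ hs hW.level fun _ hu => hu) hm
  obtain ⟨η, hη, hεη⟩ := hW.limit ε hε
  obtain ⟨r, hr⟩ := h.exists_level (h.index_lt hW.level hη)
  exact ⟨η, r, hη, hr, fun y hy => h.mem_level hεη ht hr fun u hu => hst u (hy u hu),
    fun y hy => h.level_subset hεη ht hr (hst y hy),
    fun u hu => h.level_subset hεη ht hr (hmt u hu)⟩

theorem adjoinClosed : AdjoinClosed W := by
  constructor
  · obtain ⟨δ, hδ⟩ := hW.pos
    obtain ⟨s, hs⟩ := h.exists_level (h.index_lt hW.level hδ)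
    exact h.mem_level hδ hs hW.level fun u hu => absurd hu (not_mem_empty u)
  · intro x y z hx hy hz
    obtain ⟨δ, s, hδ, hs, hxs, hys⟩ := h.exists_common_level hW.level hx hy
    obtain ⟨ε, t, hε, ht, h1, h2, -⟩ := exists_level_gt h hW hδ hs hx
    refine h.mem_level hε ht hW.level fun u hu => ?_
    rcases (hz u).1 hu with hu | rfl
    exacts [h2 u (hxs u hu), h1 u hys]

/-- The hereditarily finite sets form a subset of `V_β`, and `β < α` places this subset in `V_α`. -/
theorem isSuitable : IsSuitable V where
  trans := h.mem_trans
  swelled := h.level_swelled h.top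
  exists_hf := by
    obtain ⟨H, hH, hHW⟩ := (adjoinClosed h hW).exists_isHF
    exact ⟨H, h.mem_level hW.lt hW.level h.top hHW, hH⟩

variable [IsSuitable V]

theorem hf_subset {x : M} (hx : x ∈ hf V) : x ∈ W := (isHF_hf V).2 W (adjoinClosed h hW) x hx

/-- Let `y ⊆ V_δ`. If `δ < β`, the few extra ranks needed for singletons and marker are available
below the limit `β`. If `δ ≥ β`, only hereditarily finite elements are changed or added, and these
stay in `V_β ⊆ V_δ`. -/
theorem exists_isFlatPair {γ t ψ y : M} (ht : App f γ t) (hγ : γ = β ∨ β ∈ γ) (hψ : ψ ∈ hf V)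
    (hy : y ∈ t) : ∃ w, w ∈ t ∧ IsFlatPair V w ψ y := by
  have hm := marker_mem_hf hψ
  obtain ⟨δ, s, hδ, hs, hys⟩ := (h.recursion γ t ht y).1 hy
  have hδα := h.index_lt ht hδ
  by_cases hδβ : δ ∈ β
  · obtain ⟨ε, r, hε, hr, h1, h2, h3⟩ := exists_level_gt h hW hδβ hs
      (hf_subset h hW ((isHF_hf V).upair_mem hm hm))
    obtain ⟨w, hw, hwr⟩ := exists_isFlatPair_of_subset (V := V) (fun e he => h2 e (hys e he))
      (fun e he _ => h1 _ fun u hu => by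
        obtain rfl : u = e := by simpa [mem_upair] using hu
        exact hys u he) (h3 _ ((mem_upair _ _ _).2 (Or.inl rfl)))
    refine ⟨w, ?_, hw⟩
    have hwW := h.mem_level hε hr hW.level hwr
    rcases hγ with rfl | hγ
    · exact h.level_unique hW.level ht ▸ hwW
    · exact h.level_subset hγ hW.level ht hwW
  · have hWs : ∀ x, x ∈ W → x ∈ s := fun x hx => by
      rcases h.ordinal.2 _ _ hδα hW.lt with hlt | rfl | hlt
      · exact absurd hlt hδβ
      · exact h.level_unique hW.level hs ▸ hx
      · exact h.level_subset hlt hW.level hs hx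
    obtain ⟨w, hw, hws⟩ := exists_isFlatPair_of_subset (V := V) hys
      (fun e _ he => hWs _ (hf_subset h hW ((isHF_hf V).upair_mem he he)))
      (hWs _ (hf_subset h hW hm))
    exact ⟨w, h.mem_level hδ hs ht hws, hw⟩

/-- The flat pairs with second component in a given set `b` of `V` belong to a set of `V`. -/
theorem exists_flatPairs {b : M} (hb : b ∈ V) :
    ∃ t, t ∈ V ∧ ∀ ψ y, ψ ∈ hf V → y ∈ b → ∃ w, w ∈ t ∧ IsFlatPair V w ψ y := by
  obtain ⟨γ, t, hγ, ht, hbt⟩ := (h.recursion α V h.top b).1 hb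
  -- The level that includes `b` is raised to at least `β`, where flat pairs stay inside.
  have key : ∃ γ t, γ ∈ α ∧ App f γ t ∧ (γ = β ∨ β ∈ γ) ∧ ∀ y, y ∈ b → y ∈ t := by
    rcases h.ordinal.2 _ _ hγ hW.lt with hlt | rfl | hlt
    · exact ⟨β, W, hW.lt, hW.level, Or.inl rfl,
        fun y hy => h.level_subset hlt ht hW.level (hbt y hy)⟩
    · exact ⟨γ, t, hγ, ht, Or.inl rfl, hbt⟩
    · exact ⟨γ, t, hγ, ht, Or.inr hlt, hbt⟩
  obtain ⟨γ, t, hγ, ht, hγβ, hbt⟩ := key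
  exact ⟨t, h.mem_level hγ ht h.top fun _ hu => hu,
    fun ψ y hψ hy => exists_isFlatPair h hW ht hγβ hψ (hbt y hy)⟩

end IsLimitLevel

/-! ### Hereditarily finite sets are fixed -/

/-- By induction on the generation of hereditarily finite sets: `∅` is definable, and `x ∪ {y}` is
definable from `x` and `y`. -/
theorem IsPreserving.app_of_mem_hf {V k : M} [HasTruth V] [IsSuitable V] (hk : IsPreserving V k) :
    ∀ x, x ∈ hf V → App k x x := by
  refine (isHF_hf V).induction (fun x => App k x x) ?_ fun x y z hx hy hz hx' hy' hadj => ?_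
  · obtain ⟨e, he⟩ := hk.exists_app ⟨empty, empty_mem⟩
    have := (hk.preserves (fun e _ _ _ _ => e.1 = empty) he he he he he).1 rfl
    rwa [this] at he
  · obtain ⟨z', hz'⟩ := hk.exists_app ⟨z, mem_of_mem_hf hz⟩
    have hx : App k (⟨x, mem_of_mem_hf hx⟩ : Carrier V).1 (⟨x, mem_of_mem_hf hx⟩ : Carrier V).1 :=
      hx'
    have hy : App k (⟨y, mem_of_mem_hf hy⟩ : Carrier V).1 (⟨y, mem_of_mem_hf hy⟩ : Carrier V).1 :=
      hy'
    have := (hk.preserves (fun x y z _ _ => IsAdjoin z.1 x.1 y.1) hx hy hz' hz' hz').1 hadj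
    rwa [this.unique hadj] at hz'

/-! ### Relations defined by a formula and a parameter -/

/-- `(V, ∈) ⊨ φ(x, y, q)`, where all variables after the first two have value `q`. -/
def SatisfiesPair (V φ x y q : M) : Prop :=
  ∃ s, IsAssignment V s ∧ App s (num 0) x ∧ App s (num 1) y ∧
    (∀ i, IsNat i → i ≠ num 0 → i ≠ num 1 → App s i q) ∧ Satisfies V φ s

/-- `k` is the relation on `V` defined by the formula `φ` from the parameter `q`. -/
def IsDefinedBy (V φ k q : M) : Prop :=
  ∀ x y, App k x y ↔ x ∈ V ∧ y ∈ V ∧ SatisfiesPair V φ x y q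

/-- `p` is the section of an image `k(a)` at an element of an image `k(b)`. -/
def IsImageSection (V k p : M) : Prop :=
  ∃ a a' b b' x, App k a a' ∧ App k b b' ∧ x ∈ b' ∧ RelSection V p a' x

section

variable {n : ℕ} {g₁ g₂ g₃ g₄ g₅ : (Fin n → M) → M} [DfnFun (ambient M) g₁]
  [DfnFun (ambient M) g₂] [DfnFun (ambient M) g₃] [DfnFun (ambient M) g₄]

instance dfn_satisfiesPair [DfnFun (ambient M) g₅] :
    Dfn (ambient M) fun v => SatisfiesPair (g₁ v) (g₂ v) (g₃ v) (g₄ v) (g₅ v) :=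
  Dfn.comp₅ SatisfiesPair (by unfold SatisfiesPair; infer_instance)

instance dfn_isDefinedBy : Dfn (ambient M) fun v => IsDefinedBy (g₁ v) (g₂ v) (g₃ v) (g₄ v) :=
  Dfn.comp₄ IsDefinedBy (by unfold IsDefinedBy; infer_instance)

instance dfn_relSection : Dfn (ambient M) fun v => RelSection (g₁ v) (g₂ v) (g₃ v) (g₄ v) :=
  Dfn.comp₄ RelSection (by unfold RelSection; infer_instance)

instance dfn_isImageSection : Dfn (ambient M) fun v => IsImageSection (g₁ v) (g₂ v) (g₃ v) :=
  Dfn.comp₃ IsImageSection (by unfold IsImageSection; infer_instance)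

end

section

variable {V φ : M}

theorem IsDefinedBy.app_iff {k : M} {x y q : Carrier V} (h : IsDefinedBy V φ k q.1) :
    App k x.1 y.1 ↔ Sat V φ ![x, y] q := by
  have hval : (fun i => (![x, y] i).1) = ![x.1, y.1] := by
    funext i
    fin_cases i <;> rfl
  unfold Sat
  simp only [SatisfiesPair, hval, isTuple_two_iff, h x.1 y.1, x.2, y.2, true_and, and_assoc]

theorem DefinableFrom.exists_isDefinedBy {k p : M} (hk : IsFunction k V V)
    (h : DefinableFrom V k p) : p ∈ V ∧ ∃ φ, IsFormula φ ∧ IsDefinedBy V φ k p := by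
  obtain ⟨hp, φ, hφ, h⟩ := h
  refine ⟨hp, φ, hφ, fun x y => ⟨fun hxy => ?_, fun ⟨hx, hy, hs⟩ => (h x y hx hy).2 hs⟩⟩
  have := hk.mem hxy
  exact ⟨this.1, this.2, (h x y this.1 this.2).1 hxy⟩

theorem IsDefinedBy.definableFrom {k p : M} (hp : p ∈ V) (hφ : IsFormula φ)
    (h : IsDefinedBy V φ k p) : DefinableFrom V k p :=
  ⟨hp, φ, hφ, fun x y hx hy => (h x y).trans (by simp only [hx, hy, true_and]; exact Iff.rfl)⟩

theorem exists_isDefinedBy (V φ q : M) : ∃ k, IsDefinedBy V φ k q ∧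
    ∀ p, p ∈ k → ∃ x y, x ∈ V ∧ y ∈ V ∧ p = opair x y := by
  obtain ⟨w, hw⟩ := exists_product V V
  obtain ⟨k, hk⟩ := exists_sep (fun p => ∃ x y, x ∈ V ∧ y ∈ V ∧ p = opair x y ∧
    SatisfiesPair V φ x y q) w
  refine ⟨k, fun x y => ?_, fun p hp => ?_⟩
  · unfold App
    rw [hk]
    constructor
    · rintro ⟨-, x', y', hx, hy, he, h⟩
      obtain ⟨rfl, rfl⟩ := opair_inj.1 he
      exact ⟨hx, hy, h⟩
    · rintro ⟨hx, hy, h⟩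
      exact ⟨hw x y hx hy, x, y, hx, hy, rfl, h⟩
  · obtain ⟨-, x, y, hx, hy, he, -⟩ := (hk p).1 hp
    exact ⟨x, y, hx, hy, he⟩

/-- The relation defined by `φ` from `q` preserves the formula `ψ`. -/
def RelPreserves (V φ ψ : M) (q : Carrier V) : Prop :=
  ∀ x₀ x₁ x₂ x₃ x₄ y₀ y₁ y₂ y₃ y₄ : Carrier V,
    Sat V φ ![x₀, y₀] q → Sat V φ ![x₁, y₁] q → Sat V φ ![x₂, y₂] q → Sat V φ ![x₃, y₃] q →
      Sat V φ ![x₄, y₄] q → (Sat V ψ ![x₀, x₁, x₂, x₃] x₄ ↔ Sat V ψ ![y₀, y₁, y₂, y₃] y₄)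

theorem IsDefinedBy.relPreserves_iff {k ψ : M} {q : Carrier V} (h : IsDefinedBy V φ k q.1) :
    RelPreserves V φ ψ q ↔ PreservesFormula V k ψ := by
  rw [preservesFormula_iff fun x y hxy => ⟨((h x y).1 hxy).1, ((h x y).1 hxy).2.1⟩]
  simp only [h.app_iff, RelPreserves]

variable [HasTruth V] {n : ℕ} {g₁ g₂ g₃ g₄ g₅ : (Fin n → Carrier V) → Carrier V}
  [DfnFun (inner V) g₁] [DfnFun (inner V) g₂] [DfnFun (inner V) g₃] [DfnFun (inner V) g₄]
  [DfnFun (inner V) g₅]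

instance inner_sat_two [hφ : Fact (IsFormula φ)] :
    Dfn (inner V) fun v => Sat V φ ![g₁ v, g₂ v] (g₃ v) :=
  Dfn.comp₃ (fun a b c => Sat V φ ![a, b] c) ((dfn_sat hφ.out 2).congr fun v => by
    refine iff_of_eq (congrArg (fun w => Sat V φ w _) (funext fun i => ?_))
    fin_cases i <;> rfl)

instance inner_sat_four [hφ : Fact (IsFormula φ)] :
    Dfn (inner V) fun v => Sat V φ ![g₁ v, g₂ v, g₃ v, g₄ v] (g₅ v) :=
  Dfn.comp₅ (fun a b c d e => Sat V φ ![a, b, c, d] e) ((dfn_sat hφ.out 4).congr fun v => by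
    refine iff_of_eq (congrArg (fun w => Sat V φ w _) (funext fun i => ?_))
    fin_cases i <;> rfl)

instance inner_relPreserves {ψ : M} [Fact (IsFormula φ)] [Fact (IsFormula ψ)] :
    Dfn (inner V) fun v => RelPreserves V φ ψ (g₁ v) :=
  Dfn.comp₁ (RelPreserves V φ ψ) (by unfold RelPreserves; infer_instance)

end

/-! ### Reflection of a definable map -/

/-- The relations that `φ` defines from the section of `a` at an element `x` of `b`: all flat
pairs of `x` and a hereditarily finite set belong to `C`, the relation is a function, its
parameter is an image section, and it moves an element of `z`. -/
def Reflects (V φ : M) [IsSuitable V] (b C a z : Carrier V) : Prop :=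
  ∃ x : Carrier V, x ∈ b ∧
    (∀ ψ : Carrier V, ψ.1 ∈ hf V → ∀ w : Carrier V, IsFlatPair V w.1 ψ.1 x.1 → w ∈ C) ∧
    ∃ q : Carrier V, RelSection V q.1 a.1 x.1 ∧ (∀ u : Carrier V, ∃! v, Sat V φ ![u, v] q) ∧
      (∃ a₁ a₁' b₁ b₁' x₁ : Carrier V, Sat V φ ![a₁, a₁'] q ∧ Sat V φ ![b₁, b₁'] q ∧
        x₁ ∈ b₁' ∧ RelSection V q.1 a₁'.1 x₁.1) ∧
      ∃ u : Carrier V, u ∈ z ∧ ¬ Sat V φ ![u, u] q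

instance inner_reflects {V φ : M} [HasTruth V] [IsSuitable V] [Fact (IsFormula φ)] {n : ℕ}
    {g₁ g₂ g₃ g₄ : (Fin n → Carrier V) → Carrier V} [DfnFun (inner V) g₁] [DfnFun (inner V) g₂]
    [DfnFun (inner V) g₃] [DfnFun (inner V) g₄] :
    Dfn (inner V) fun v => Reflects V φ (g₁ v) (g₂ v) (g₃ v) (g₄ v) :=
  Dfn.comp₄ (Reflects V φ) (by unfold Reflects; infer_instance)

section Reflection

variable {V : M} [IsSuitable V]

/-- There is a set `C` of flat pairs of formulas `ψ` and elements `y` of `b` such that `ψ` is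
preserved by the relation that `φ` defines from the section of `a` at `y`. -/
theorem exists_preservation_set
    (hflat : ∀ b, b ∈ V →
      ∃ t, t ∈ V ∧ ∀ ψ y, ψ ∈ hf V → y ∈ b → ∃ w, w ∈ t ∧ IsFlatPair V w ψ y)
    (φ : M) (a b : Carrier V) : ∃ C : Carrier V,
    ∀ y w : Carrier V, y ∈ b → ∀ ψ, ψ ∈ hf V → IsFlatPair V w.1 ψ y.1 → (w ∈ C ↔
      (IsFormula ψ → ∀ q : Carrier V, RelSection V q.1 a.1 y.1 → RelPreserves V φ ψ q)) := by
  obtain ⟨t, htV, ht⟩ := hflat b.1 b.2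
  -- Preservation is phrased through graphs `k` in `M`, which separation in `M` can handle. For
  -- non-formulas `ψ` the condition is vacuous, so `Reflects` can range over all of `hf V` without
  -- expressing in `V` what a formula is.
  obtain ⟨C, hC⟩ := exists_sep (fun w => ∃ ψ y, ψ ∈ hf V ∧ y ∈ b.1 ∧ IsFlatPair V w ψ y ∧
    (IsFormula ψ → ∀ q, q ∈ V → RelSection V q a.1 y →
      ∀ k, IsDefinedBy V φ k q → PreservesFormula V k ψ)) t
  refine ⟨⟨C, IsSuitable.swelled htV fun w hw => ((hC w).1 hw).1⟩, fun y w hy ψ hψ hw => ?_⟩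
  have hwt : w.1 ∈ t := by
    obtain ⟨w', hw't, hw'⟩ := ht ψ y.1 hψ hy
    rwa [hw.unique w.2 (IsSuitable.trans htV hw't) hw']
  refine (hC w.1).trans ?_
  constructor
  · rintro ⟨-, ψ', y', hψ', hy', hw', h⟩ hφ q hq
    obtain ⟨rfl, rfl⟩ := hw.inj hψ y.2 (IsSuitable.trans b.2 hy') hw'
    obtain ⟨k, hk, -⟩ := exists_isDefinedBy V φ q.1
    exact hk.relPreserves_iff.2 (h hφ q.1 q.2 hq k hk)
  · intro h
    refine ⟨hwt, ψ, y.1, hψ, hy, hw, fun hφ q hq hqa k hk => ?_⟩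
    exact IsDefinedBy.relPreserves_iff (q := ⟨q, hq⟩) hk |>.1 (h hφ ⟨q, hq⟩ hqa)

variable [HasTruth V]

/-- The statement is verified for the images of `b`, `C`, `a`, `z`, with witnesses `x` and `p`, and
then pulled back along `k`. -/
theorem reflects_of_isDefinedBy {k φ : M} [Fact (IsFormula φ)] (hk : IsPreserving V k)
    {a a' b b' x p z C : Carrier V} (ha : App k a.1 a'.1) (hb : App k b.1 b'.1) (hx : x ∈ b')
    (hp : RelSection V p.1 a'.1 x.1) (hkφ : IsDefinedBy V φ k p.1) (hz : ¬ App k z.1 z.1)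
    (hfix : ∀ u, u ∈ z.1 → App k u u)
    (hC : ∀ y w : Carrier V, y ∈ b → ∀ ψ, ψ ∈ hf V → IsFlatPair V w.1 ψ y.1 → (w ∈ C ↔
      (IsFormula ψ → ∀ q : Carrier V, RelSection V q.1 a.1 y.1 → RelPreserves V φ ψ q))) :
    Reflects V φ b C a z := by
  obtain ⟨C', hC'⟩ := hk.exists_app C
  obtain ⟨z', hz'⟩ := hk.exists_app z
  refine (hk.preserves (fun b C a z _ => Reflects V φ b C a z) hb hC' ha hz' hz').2 ?_
  refine ⟨x, hx, fun ψ hψ w hw => ?_, p, hp, fun u => ?_,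
    ⟨a, a', b, b', x, hkφ.app_iff.1 ha, hkφ.app_iff.1 hb, hx, hp⟩, ?_⟩
  · have hψψ := hk.app_of_mem_hf ψ.1 hψ
    by_cases hform : IsFormula ψ.1
    · have : Fact (IsFormula ψ.1) := ⟨hform⟩
      -- One transfer for each `ψ`: its code enters as the fixed point `χ`, while `RelPreserves` for
      -- this particular `ψ` is built into the transferred formula.
      refine (hk.preserves (fun b C a χ _ => ∀ y : Carrier V, y ∈ b →
        (∀ q : Carrier V, RelSection V q.1 a.1 y.1 → RelPreserves V φ ψ.1 q) →
          ∀ w : Carrier V, IsFlatPair V w.1 χ.1 y.1 → w ∈ C) hb hC' ha hψψ hψψ).1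
        (fun y hy h w hw => (hC y w hy ψ.1 hψ hw).2 fun _ => h) x hx (fun q hq => ?_) w hw
      -- The section at `x` is unique in `V`, so the relation in question is `k` itself, which
      -- preserves `ψ`.
      obtain rfl : q = p := Subtype.ext (hq.unique q.2 p.2 hp)
      exact hkφ.relPreserves_iff.2 (hk.2 ψ.1 hform)
    · exact (hk.preserves (fun b C χ _ _ => ∀ y : Carrier V, y ∈ b →
        ∀ w : Carrier V, IsFlatPair V w.1 χ.1 y.1 → w ∈ C) hb hC' hψψ hψψ hψψ).1
        (fun y hy w hw => (hC y w hy ψ.1 hψ hw).2 fun h => absurd h hform) x hx w hw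
  · obtain ⟨v, hv⟩ := hk.exists_app u
    exact ⟨v, hkφ.app_iff.1 hv, fun v' hv' =>
      Subtype.ext (hk.1.unique (hkφ.app_iff.2 hv') hv)⟩
  · obtain ⟨u, hu, hne⟩ := hk.exists_moved IsSuitable.trans hz' hz hfix
    exact ⟨u, hu, fun h => hne (hkφ.app_iff.2 h)⟩

/-- If a definable map moves `z` but no element of `z`, then an element of `z` is moved by another
map of the same kind. -/
theorem exists_moved_of_definableFrom
    (hflat : ∀ b, b ∈ V →
      ∃ t, t ∈ V ∧ ∀ ψ y, ψ ∈ hf V → y ∈ b → ∃ w, w ∈ t ∧ IsFlatPair V w ψ y)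
    {k p z : M} (hk : IsPreserving V k)
    (hp : IsImageSection V k p) (hdef : DefinableFrom V k p) (hzV : z ∈ V) (hz : ¬ App k z z)
    (hfix : ∀ u, u ∈ z → App k u u) :
    ∃ u k₁ p₁, u ∈ z ∧ IsPreserving V k₁ ∧ IsImageSection V k₁ p₁ ∧ DefinableFrom V k₁ p₁ ∧
      ¬ App k₁ u u := by
  obtain ⟨hpV, φ, hφ, hkφ⟩ := hdef.exists_isDefinedBy hk.1
  obtain ⟨a, a', b, b', x, ha, hb, hxb, hpx⟩ := hp
  have : Fact (IsFormula φ) := ⟨hφ⟩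
  obtain ⟨haV, ha'V⟩ := hk.1.mem ha
  obtain ⟨hbV, hb'V⟩ := hk.1.mem hb
  obtain ⟨C, hC⟩ := exists_preservation_set hflat φ ⟨a, haV⟩ ⟨b, hbV⟩
  obtain ⟨y, hy, hyC, q, hq, hfun, ⟨a₁, a₁', b₁, b₁', x₁, ha₁, hb₁, hx₁, hqx⟩, u, hu, hne⟩ :=
    reflects_of_isDefinedBy hk (a := ⟨a, haV⟩) (a' := ⟨a', ha'V⟩) (b := ⟨b, hbV⟩)
      (b' := ⟨b', hb'V⟩) (x := ⟨x, IsSuitable.trans hb'V hxb⟩) (p := ⟨p, hpV⟩) (z := ⟨z, hzV⟩)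
      ha hb hxb hpx hkφ hz hfix hC
  obtain ⟨k₁, hk₁, hk₁p⟩ := exists_isDefinedBy V φ q.1
  refine ⟨u.1, k₁, q.1, hu, ⟨⟨hk₁p, fun v hv => ?_⟩, fun ψ hψ => ?_⟩,
    ⟨a₁.1, a₁'.1, b₁.1, b₁'.1, x₁.1, hk₁.app_iff.2 ha₁, hk₁.app_iff.2 hb₁, hx₁, hqx⟩,
    hk₁.definableFrom q.2 hφ, fun h => hne (hk₁.app_iff.1 h)⟩
  · obtain ⟨v', hv', huniq⟩ := hfun ⟨v, hv⟩
    refine ⟨v'.1, hk₁.app_iff.2 hv', fun v'' hv'' => ?_⟩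
    have hV := ((hk₁ _ _).1 hv'').2.1
    exact congrArg Subtype.val (huniq ⟨v'', hV⟩
      ((hk₁.app_iff (x := ⟨v, hv⟩) (y := ⟨v'', hV⟩)).1 hv''))
  · have hψ' := (isHF_hf V).isFormula_mem hψ
    obtain ⟨t, htV, ht⟩ := hflat b hbV
    obtain ⟨w, hw, hwψ⟩ := ht ψ y.1 hψ' hy
    have hwC := hyC ⟨ψ, mem_of_mem_hf hψ'⟩ hψ' ⟨w, IsSuitable.trans htV hw⟩ hwψ
    -- Membership of the code of `(ψ, y)` in `C` is decoded into preservation of `ψ` by `k₁`; this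
    -- is how all formulas are recovered from one reflected statement.
    exact hk₁.relPreserves_iff.1 ((hC y _ hy ψ hψ' hwψ).1 hwC hψ q hq)

end Reflection

/-- `Satisfies` asserts the existence of a truth set, so evaluating the definition at `p` and its
image supplies one; no recursion is needed to construct it. -/
theorem DefinableFrom.hasTruth {V j p : M} (hj : IsFunction j V V) (h : DefinableFrom V j p) :
    HasTruth V := by
  obtain ⟨hp, φ, -, h⟩ := h
  obtain ⟨y, hy⟩ := hj.exists hp
  obtain ⟨s, -, -, -, -, T, hT, -⟩ := (h p y hp (hj.mem hy).2).1 hy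
  exact ⟨⟨T, hT⟩, ⟨p, hp⟩⟩

end ChoicelessZF
open ChoicelessZF in
theorem theorem3p9 {M : Type*} [Membership M M] [IsZF M]
    (α V j : M) (hV : IsVonNeumann α V)
    (hj : IsElementary V j) (hne : ∃ x ∈ V, ¬ App j x x)
    (a b ja jb : M) (ha : a ∈ V) (hb : b ∈ V) (hja : App j a ja) (hjb : App j b jb)
    (p : M) (hp : MemSections p ja jb) :
    ¬ DefinableFrom V j p := by
  intro hdef
  obtain ⟨f, hf⟩ := hV.exists_hierarchy
  have := hdef.hasTruth hj.1
  obtain ⟨β, W, hW⟩ := hf.exists_isLimitLevel hj.isPreserving hne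
  have := hW.isSuitable hf
  obtain ⟨x, hxjb, hpx⟩ := hp
  obtain ⟨z₀, hz₀V, hz₀⟩ := hne
  -- The minimum is taken over the sets moved by any map of this kind, not by `j` alone, because
  -- reflection produces a different map `k₁`.
  obtain ⟨z, hzV, ⟨k, q, hk, hq, hkq, hz⟩, hmin⟩ := exists_minimal
    (fun z => ∃ k q, IsPreserving V k ∧ IsImageSection V k q ∧ DefinableFrom V k q ∧ ¬ App k z z)
    hz₀V ⟨j, p, hj.isPreserving, ⟨a, ja, b, jb, x, hja, hjb, hxjb, fun y _ => hpx y⟩, hdef, hz₀⟩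
  have hfix : ∀ u, u ∈ z → App k u u := fun u hu => by
    by_contra hcon
    exact hmin u hu (hf.mem_trans hzV hu) ⟨k, q, hk, hq, hkq, hcon⟩
  obtain ⟨u, k₁, p₁, hu, hk₁, hp₁, hdef₁, hne₁⟩ := exists_moved_of_definableFrom
    (fun b hb => hW.exists_flatPairs hf hb) hk hq hkq hzV hz hfix
  exact hmin u hu (hf.mem_trans hzV hu) ⟨k₁, p₁, hk₁, hp₁, hdef₁, hne₁⟩
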